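/- Let $B=\{z\in\mathbb C^n : |z|\le 1\}$ be the closed unit ball, with boundary sphere $\partial B=\{|z|=1\}$, and equip $\mathbb C^n$ with the standard symplectic form $\omega=\sum_j dx_j\wedge dy_j$, where $z_j=x_j+iy_j$. A *closed Lagrangian submanifold* of $\mathbb C^n$ is a compact smooth embedded submanifold without boundary, of real dimension $n$, on whose tangent spaces $\omega$ vanishes (it need not be connected). A *Hamiltonian isotopy* of $\mathbb C^n$ is a smooth family $(\varphi_t)_{t\in[0,1]}$ of diffeomorphisms of $\mathbb C^n$ with $\varphi_0=\mathrm{id}$ and $\frac{d}{dt}\varphi_t=X_t\circ\varphi_t$, where $\omega(X_t,\cdot)=dH_t$ for a smooth function $H:[0,1]\times\mathbb C^n\to\mathbb R$, $H_t=H(t,\cdot)$. A *Hamiltonian isotopy of closed Lagrangian submanifolds* is a family $(L_t)_{t\in[0,1]}$ with $L_0$ a closed Lagrangian submanifold and $L_t=\varphi_t(L_0)$ for a Hamiltonian isotopy $(\varphi_t)$ of $\mathbb C^n$. Let $n\ge 0$. (a) Let $(L_t)_{t\in[0,1]}$ be a Hamiltonian isotopy of closed Lagrangian submanifolds such that $L_t\subset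 B$ for all $t\in[0,1]$. If $L_0\subset\partial B$, then $L_t\subset\partial B$ for all $t\in[0,1]$. (b) Consequently, no point of a closed Lagrangian submanifold in $\partial B$ can be pushed into the interior of $B$ without another point leaving $B$: if $L\subset\partial B$ is a closed Lagrangian submanifold, $(\varphi_t)_{t\in[0,1]}$ is a Hamiltonian isotopy of $\mathbb C^n$, and $|\varphi_t(p)|<1$ for some $p\in L$ and $t\in[0,1]$, then there are $s\in[0,t]$ and $q\in L$ with $q\ne p$ and $\varphi_s(q)\notin B$. -/

import Mathlib

open Set Filter Topology
open scoped ContDiff Manifold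

/-- Complex `n`-space with its Euclidean norm. -/
abbrev Cn (n : ℕ) : Type := EuclideanSpace ℂ (Fin n)

/-- Real Euclidean `k`-space. -/
abbrev Rn (k : ℕ) : Type := EuclideanSpace ℝ (Fin k)

/-- The standard symplectic form `∑ⱼ dxⱼ ∧ dyⱼ` on `ℂⁿ`, where `zⱼ = xⱼ + i yⱼ`. -/
def stdSymplecticForm {n : ℕ} (u v : Cn n) : ℝ :=
  ∑ j, ((u j).re * (v j).im - (u j).im * (v j).re)

/-- `S ⊆ ℂⁿ` is a smooth embedded submanifold (without boundary) of real dimension `n`: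
near each of its points there is a smooth chart of the ambient space `ℂⁿ`, with values in
`ℝⁿ × ℝⁿ`, in which `S` is the slice `ℝⁿ × {0}`. -/
def IsHalfDimSubmanifold {n : ℕ} (S : Set (Cn n)) : Prop :=
  ∀ x ∈ S, ∃ Φ : OpenPartialHomeomorph (Cn n) (Rn n × Rn n),
    x ∈ Φ.source ∧
    ContDiffOn ℝ ∞ Φ Φ.source ∧
    ContDiffOn ℝ ∞ Φ.symm Φ.target ∧
    ∀ y ∈ Φ.source, y ∈ S ↔ (Φ y).2 = 0

/-- The tangent vectors of `S` at `x`: velocities of curves in `S` through `x`. For a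
submanifold `S` these are exactly the elements of the tangent space `T_x S`. -/
def tangentVectors {n : ℕ} (S : Set (Cn n)) (x : Cn n) : Set (Cn n) :=
  {w | ∃ γ : ℝ → Cn n, γ 0 = x ∧ (∀ᶠ s in 𝓝 (0 : ℝ), γ s ∈ S) ∧ HasDerivAt γ w 0}

/-- `S` is a closed Lagrangian submanifold of `ℂⁿ`: a compact smooth embedded submanifold
without boundary, of real dimension `n`, on whose tangent spaces the symplectic form
vanishes. It need not be connected. -/
structure IsClosedLagrangian {n : ℕ} (S : Set (Cn n)) : Prop where
  isCompact : IsCompact S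
  submanifold : IsHalfDimSubmanifold S
  isotropic : ∀ x ∈ S, ∀ u ∈ tangentVectors S x, ∀ v ∈ tangentVectors S x,
    stdSymplecticForm u v = 0

/-- `X` is the Hamiltonian vector field of the function `h` : `ω(X, ·) = dh`. -/
def IsHamiltonianVectorField {n : ℕ} (X : Cn n → Cn n) (h : Cn n → ℝ) : Prop :=
  ∀ x v : Cn n, stdSymplecticForm (X x) v = fderiv ℝ h x v

/-- `(φ t)`, `t ∈ [0, 1]`, is a Hamiltonian isotopy of `ℂⁿ`: a smooth family of diffeomorphisms
of `ℂⁿ` starting at the identity that is generated by the Hamiltonian vector fields `X t` of a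
smooth time-dependent function `H : [0, 1] × ℂⁿ → ℝ`, that is, `dφ_t/dt = X_t ∘ φ_t`.
Only the times `t ∈ [0, 1]` matter; at the end points derivatives in `t` are one-sided. -/
def IsHamiltonianIsotopy {n : ℕ} (φ : ℝ → Diffeomorph 𝓘(ℝ, Cn n) 𝓘(ℝ, Cn n) (Cn n) (Cn n) ∞) :
    Prop :=
  ContDiffOn ℝ ∞ (fun p : ℝ × Cn n => φ p.1 p.2) (Icc (0 : ℝ) 1 ×ˢ univ) ∧
  (∀ x, φ 0 x = x) ∧
  ∃ (H : ℝ → Cn n → ℝ) (X : ℝ → Cn n → Cn n),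
    ContDiffOn ℝ ∞ (fun p : ℝ × Cn n => H p.1 p.2) (Icc (0 : ℝ) 1 ×ˢ univ) ∧
    ∀ t ∈ Icc (0 : ℝ) 1, IsHamiltonianVectorField (X t) (H t) ∧
      ∀ x, HasDerivWithinAt (fun s => φ s x) (X t (φ t x)) (Icc (0 : ℝ) 1) t

/-- `(L t)`, `t ∈ [0, 1]`, is a Hamiltonian isotopy of closed Lagrangian submanifolds of `ℂⁿ`:
`L 0` is a closed Lagrangian submanifold and `L t = φ_t (L 0)` for a Hamiltonian isotopy `(φ_t)`
of `ℂⁿ`. (Every `L t` is then a closed Lagrangian submanifold.) -/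
def IsLagrangianHamiltonianIsotopy {n : ℕ} (L : ℝ → Set (Cn n)) : Prop :=
  IsClosedLagrangian (L 0) ∧
  ∃ φ : ℝ → Diffeomorph 𝓘(ℝ, Cn n) 𝓘(ℝ, Cn n) (Cn n) (Cn n) ∞,
    IsHamiltonianIsotopy φ ∧ ∀ t ∈ Icc (0 : ℝ) 1, L t = φ t '' L 0

/-! ### Linear symplectic algebra of `ℂⁿ` -/

/-! If a Lagrangian `S` lies in the sphere, each `z ∈ S` is orthogonal to `T_z S`. Since the
orthogonal complement of a Lagrangian plane `T` is `i T`, this gives `i z ∈ T_z S`, so `S` is a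
union of Hopf circles `θ ↦ e^{iθ} z` (`IsClosedLagrangian.hopf_mem`).

Let `ψ_t` be a Hamiltonian flow that is close to the identity and keeps `S` in the ball, let `q ∈
S`, and let `p` be a point of `S` nearest to `ψ_t q`. Both `ψ_t q - p` and `p` are orthogonal to `T
= T_p S`, hence so is `ψ_t q`. A periodic implicit function theorem (`exists_uniform_loop`) extends
`q` to a loop `l(θ) = e^{iθ} χ(x(θ))` in `S` with `l(0) = q`, such that `ν(θ) = e^{-iθ} ψ_t(l(θ))`
stays in `i T`.

The action `∫ ω(c, c')` of this loop is computed twice. The loop deforms inside `S` to a Hopf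
circle, so its action is `2π` (`loopAction_hopf_param`), and Hamiltonian flows preserve action. On
the other hand `i T` is isotropic, so `ω(ν, ν') = 0`, which for `c = ψ_t ∘ l` reads `ω(c, c') =
|c|²` (`symplecticL_deriv_of_orthogonal`). Thus `∫ |c|² = 2π` with `|c| ≤ 1`, which forces `|c| = 1`
and in particular `|ψ_t q| = 1` (`norm_eq_one_of_loop`).

Compactness of `S` makes this uniform in `q`, and an open-closed argument in time gives (a). For
(b), `p` is a limit of other points on its Hopf circle, so it cannot be the only point to leave the
ball, and (a) applies. -/

theorem stdSymplecticForm_eq_im_inner {n : ℕ} (u v : Cn n) :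
    stdSymplecticForm u v = (inner ℂ u v).im := by
  simp only [stdSymplecticForm, PiLp.inner_apply, Complex.im_sum]
  refine Finset.sum_congr rfl fun j _ => ?_
  simp [Complex.mul_im]
  ring

/-- The standard symplectic form as a continuous real bilinear map. -/
noncomputable def symplecticL (n : ℕ) : Cn n →L[ℝ] Cn n →L[ℝ] ℝ :=
  LinearMap.mkContinuous₂
    (LinearMap.mk₂ ℝ (fun u v : Cn n => stdSymplecticForm u v)
      (by intros; simp [stdSymplecticForm_eq_im_inner])
      (by
        intro c u v
        simp only [stdSymplecticForm, Finset.mul_sum, smul_eq_mul, PiLp.smul_apply,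
          Complex.real_smul, Complex.mul_re, Complex.mul_im, Complex.ofReal_re, Complex.ofReal_im]
        refine Finset.sum_congr rfl fun j _ => ?_
        ring)
      (by intros; simp [stdSymplecticForm_eq_im_inner])
      (by
        intro c u v
        simp only [stdSymplecticForm, Finset.mul_sum, smul_eq_mul, PiLp.smul_apply,
          Complex.real_smul, Complex.mul_re, Complex.mul_im, Complex.ofReal_re, Complex.ofReal_im]
        refine Finset.sum_congr rfl fun j _ => ?_
        ring))
    1 (by
      intro u v
      simp only [LinearMap.mk₂_apply, stdSymplecticForm_eq_im_inner, one_mul, Real.norm_eq_abs]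
      exact (Complex.abs_im_le_norm _).trans (norm_inner_le_norm u v))

theorem symplecticL_apply {n : ℕ} (u v : Cn n) : symplecticL n u v = stdSymplecticForm u v := rfl

theorem symplecticL_eq_im_inner {n : ℕ} (u v : Cn n) : symplecticL n u v = (inner ℂ u v).im :=
  stdSymplecticForm_eq_im_inner u v

theorem symplecticL_antisymm {n : ℕ} (u v : Cn n) : symplecticL n u v = -symplecticL n v u := by
  rw [symplecticL_eq_im_inner, symplecticL_eq_im_inner, ← inner_conj_symm, Complex.conj_im]

/-- The real inner product is `ω(·, i ·)`. Orthogonality and squared norms are written in this form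
throughout, so that one bilinear form suffices. -/
theorem symplecticL_I_right {n : ℕ} (u v : Cn n) :
    symplecticL n u (Complex.I • v) = (inner ℂ u v).re := by
  simp [symplecticL_eq_im_inner]

theorem symplecticL_self_I {n : ℕ} (u : Cn n) : symplecticL n u (Complex.I • u) = ‖u‖ ^ 2 := by
  rw [symplecticL_I_right, inner_self_eq_norm_sq_to_K]
  norm_cast

theorem symplecticL_smul_smul {n : ℕ} {c : ℂ} (hc : ‖c‖ = 1) (u v : Cn n) :
    symplecticL n (c • u) (c • v) = symplecticL n u v := by
  simp only [symplecticL_eq_im_inner, inner_smul_left, inner_smul_right, ← mul_assoc]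
  rw [mul_comm c, ← Complex.normSq_eq_conj_mul_self, Complex.normSq_eq_norm_sq, hc]
  simp

theorem symplecticL_I_right_comm {n : ℕ} (u v : Cn n) :
    symplecticL n u (Complex.I • v) = symplecticL n v (Complex.I • u) := by
  rw [symplecticL_I_right, symplecticL_I_right, ← inner_conj_symm, Complex.conj_re]

theorem finrank_real_Cn (n : ℕ) : Module.finrank ℝ (Cn n) = 2 * n := by
  rw [← Module.finrank_mul_finrank ℝ ℂ (Cn n)]
  simp

/-- The orthogonal complement of a Lagrangian subspace `T` is `i T`. -/
theorem exists_eq_I_smul_of_orthogonal {n : ℕ} {D : Rn n →L[ℝ] Cn n}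
    (hinj : Function.Injective D) (hD : ∀ u v, symplecticL n (D u) (D v) = 0)
    {z : Cn n} (hz : ∀ v, symplecticL n z (Complex.I • D v) = 0) :
    ∃ w, z = Complex.I • D w := by
  let J : Cn n →ₗ[ℝ] Cn n := (Complex.I • (LinearMap.id : Cn n →ₗ[ℂ] Cn n)).restrictScalars ℝ
  have hJ : ∀ v, J v = Complex.I • v := fun v => rfl
  let Dl : Rn n →ₗ[ℝ] Cn n := D
  -- With `T` the image of `D`, the sum `T + i T` is direct because `T` is isotropic, and it fills
  -- `ℂⁿ` by dimension. A vector orthogonal to `T` then has no `T` component.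
  let S : (Rn n × Rn n) →ₗ[ℝ] Cn n := Dl.coprod (J ∘ₗ Dl)
  have hS : ∀ a b, S (a, b) = D a + Complex.I • D b := fun a b => rfl
  have hSinj : Function.Injective S := by
    rw [injective_iff_map_eq_zero]
    rintro ⟨a, b⟩ hab
    rw [hS] at hab
    have h1 : symplecticL n (D a) (Complex.I • D a) = 0 := by
      have : D a = -(Complex.I • D b) := eq_neg_of_add_eq_zero_left hab
      rw [symplecticL_I_right_comm]
      conv_lhs => arg 1; rw [this]
      rw [map_neg, neg_apply, symplecticL_smul_smul (by simp), hD, neg_zero]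
    have h2 : symplecticL n (D b) (Complex.I • D b) = 0 := by
      have : Complex.I • D b = -D a := eq_neg_of_add_eq_zero_right hab
      rw [this, map_neg, hD, neg_zero]
    rw [symplecticL_self_I] at h1 h2
    have h1' : D a = 0 := by simpa using h1
    have h2' : D b = 0 := by simpa using h2
    rw [Prod.mk_eq_zero]
    exact ⟨hinj (by rw [h1', map_zero]), hinj (by rw [h2', map_zero])⟩
  have hSsurj : Function.Surjective S := by
    refine (LinearMap.injective_iff_surjective_of_finrank_eq_finrank ?_).1 hSinj
    rw [finrank_real_Cn, Module.finrank_prod, finrank_euclideanSpace_fin]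
    ring
  obtain ⟨⟨a, b⟩, hab⟩ := hSsurj z
  rw [hS] at hab
  refine ⟨b, ?_⟩
  have h := hz a
  rw [← hab, map_add, add_apply, symplecticL_smul_smul (by simp), hD, add_zero,
    symplecticL_self_I] at h
  have h' : D a = 0 := by simpa using h
  rw [← hab, h', zero_add]

/-- The orthogonal complement of a Lagrangian subspace is isotropic. -/
theorem symplecticL_eq_zero_of_orthogonal {n : ℕ} {D : Rn n →L[ℝ] Cn n}
    (hinj : Function.Injective D) (hD : ∀ u v, symplecticL n (D u) (D v) = 0)
    {z w : Cn n} (hz : ∀ v, symplecticL n z (Complex.I • D v) = 0)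
    (hw : ∀ v, symplecticL n w (Complex.I • D v) = 0) : symplecticL n z w = 0 := by
  obtain ⟨a, rfl⟩ := exists_eq_I_smul_of_orthogonal hinj hD hz
  obtain ⟨b, rfl⟩ := exists_eq_I_smul_of_orthogonal hinj hD hw
  rw [symplecticL_smul_smul (by simp), hD]

/-! ### The action of a loop -/

/-- Twice the symplectic action of the loop `c : [0, 2π] → ℂⁿ` with velocity `c'`. -/
noncomputable def loopAction {n : ℕ} (c c' : ℝ → Cn n) : ℝ :=
  ∫ θ in (0 : ℝ)..(2 * Real.pi), symplecticL n (c θ) (c' θ)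

theorem integral_deriv_loop {f f' : ℝ → ℝ} (hf : ∀ θ, HasDerivAt f (f' θ) θ)
    (hf' : Continuous f') (hper : f (2 * Real.pi) = f 0) :
    ∫ θ in (0 : ℝ)..(2 * Real.pi), f' θ = 0 := by
  rw [intervalIntegral.integral_eq_sub_of_hasDerivAt (fun θ _ => hf θ)
    (hf'.intervalIntegrable _ _), hper, sub_self]

theorem continuous_symplecticL {n : ℕ} {X : Type*} [TopologicalSpace X] {f g : X → Cn n}
    (hf : Continuous f) (hg : Continuous g) :
    Continuous fun x => symplecticL n (f x) (g x) :=
  ((symplecticL n).continuous.comp hf).clm_apply hg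

theorem hasDerivAt_symplecticL {n : ℕ} {f g : ℝ → Cn n} {f' g' : Cn n} {θ : ℝ}
    (hf : HasDerivAt f f' θ) (hg : HasDerivAt g g' θ) :
    HasDerivAt (fun x => symplecticL n (f x) (g x))
      (symplecticL n f' (g θ) + symplecticL n (f θ) g') θ :=
  ((symplecticL n).hasFDerivAt.comp_hasDerivAt θ hf).clm_apply hg

theorem integral_eq_of_eq_sub {f g h : ℝ → ℝ} {a b : ℝ} (hf : Continuous f) (hh : Continuous h)
    (h0 : ∫ x in a..b, h x = 0) (hg : ∀ x, g x = f x - h x) :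
    ∫ x in a..b, g x = ∫ x in a..b, f x := by
  simp only [hg]
  rw [intervalIntegral.integral_sub (hf.intervalIntegrable _ _) (hh.intervalIntegrable _ _), h0,
    sub_zero]

/-- First variation of the action, with remainder. -/
theorem loopAction_sub {n : ℕ} {c₀ c₀' c₁ c₁' e : ℝ → Cn n}
    (h₀ : ∀ θ, HasDerivAt c₀ (c₀' θ) θ) (h₁ : ∀ θ, HasDerivAt c₁ (c₁' θ) θ)
    (h₀' : Continuous c₀') (h₁' : Continuous c₁')
    (hp₀ : c₀ (2 * Real.pi) = c₀ 0) (hp₁ : c₁ (2 * Real.pi) = c₁ 0)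
    (he : Continuous e) (he0 : ∫ θ in (0 : ℝ)..(2 * Real.pi), symplecticL n (e θ) (c₀' θ) = 0) :
    loopAction c₁ c₁' - loopAction c₀ c₀' = ∫ θ in (0 : ℝ)..(2 * Real.pi),
      (2 * symplecticL n (c₁ θ - c₀ θ - e θ) (c₀' θ) +
        symplecticL n (c₁ θ - c₀ θ) (c₁' θ - c₀' θ)) := by
  have k₀ : Continuous c₀ := continuous_iff_continuousAt.2 fun θ => (h₀ θ).continuousAt
  have k₁ : Continuous c₁ := continuous_iff_continuousAt.2 fun θ => (h₁ θ).continuousAt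
  have w₁ : Continuous fun θ => symplecticL n (c₁ θ) (c₁' θ) := continuous_symplecticL k₁ h₁'
  have w₀ : Continuous fun θ => symplecticL n (c₀ θ) (c₀' θ) := continuous_symplecticL k₀ h₀'
  have we : Continuous fun θ => symplecticL n (e θ) (c₀' θ) := continuous_symplecticL he h₀'
  have wd : Continuous fun θ => symplecticL n (c₀' θ) (c₁ θ - c₀ θ) +
      symplecticL n (c₀ θ) (c₁' θ - c₀' θ) :=
    (continuous_symplecticL h₀' (k₁.sub k₀)).add (continuous_symplecticL k₀ (h₁'.sub h₀'))
  have hz : ∫ θ in (0 : ℝ)..(2 * Real.pi), (symplecticL n (c₀' θ) (c₁ θ - c₀ θ) +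
      symplecticL n (c₀ θ) (c₁' θ - c₀' θ)) = 0 :=
    integral_deriv_loop (f := fun θ => symplecticL n (c₀ θ) (c₁ θ - c₀ θ))
      (fun θ => hasDerivAt_symplecticL (h₀ θ) ((h₁ θ).sub (h₀ θ))) wd (by simp [hp₀, hp₁])
  rw [loopAction, loopAction, ← intervalIntegral.integral_sub
    (w₁.intervalIntegrable _ _) (w₀.intervalIntegrable _ _)]
  -- With `d = c₁ - c₀`, the cross terms `ω(c₀, d') + ω(d, c₀')` differ from `2 ω(d, c₀')` by the
  -- derivative of the periodic function `ω(c₀, d)`. The field `e` stands for the linear part of `d`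
  -- and contributes nothing by `he0`.
  refine (integral_eq_of_eq_sub
    (f := fun θ => symplecticL n (c₁ θ) (c₁' θ) - symplecticL n (c₀ θ) (c₀' θ)) (w₁.sub w₀)
    (h := fun θ => (symplecticL n (c₀' θ) (c₁ θ - c₀ θ) +
      symplecticL n (c₀ θ) (c₁' θ - c₀' θ)) + 2 * symplecticL n (e θ) (c₀' θ))
    (wd.add (continuous_const.mul we)) ?_
    fun θ => ?_).symm
  · rw [intervalIntegral.integral_add (wd.intervalIntegrable _ _)
      ((we.intervalIntegrable _ _).const_mul 2), hz, intervalIntegral.integral_const_mul,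
      he0]
    simp
  · simp only [map_sub, sub_apply]
    rw [symplecticL_antisymm (c₀' θ) (c₁ θ), symplecticL_antisymm (c₀' θ) (c₀ θ)]
    ring

theorem norm_symplecticL_le {n : ℕ} (u v : Cn n) : ‖symplecticL n u v‖ ≤ ‖u‖ * ‖v‖ := by
  rw [symplecticL_eq_im_inner, Real.norm_eq_abs]
  exact (Complex.abs_im_le_norm _).trans (norm_inner_le_norm u v)

/-- The action is constant along a family of loops that sweeps out no symplectic area. -/
theorem loopAction_eq_of_family {n : ℕ} {a b : ℝ} (hab : a ≤ b) {c cs cθ : ℝ → ℝ → Cn n}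
    (hs : ∀ s ∈ Icc a b, ∀ θ, HasDerivWithinAt (fun s => c s θ) (cs s θ) (Icc a b) s)
    (hθ : ∀ s ∈ Icc a b, ∀ θ, HasDerivAt (c s) (cθ s θ) θ)
    (hcs : ContinuousOn (fun p : ℝ × ℝ => cs p.1 p.2) (Icc a b ×ˢ univ))
    (hcθ : ContinuousOn (fun p : ℝ × ℝ => cθ p.1 p.2) (Icc a b ×ˢ univ))
    (hper : ∀ s ∈ Icc a b, c s (2 * Real.pi) = c s 0)
    (harea : ∀ s ∈ Icc a b,
      ∫ θ in (0 : ℝ)..(2 * Real.pi), symplecticL n (cs s θ) (cθ s θ) = 0) :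
    loopAction (c b) (cθ b) = loopAction (c a) (cθ a) := by
  have slice : ∀ {f : ℝ → ℝ → Cn n}, ContinuousOn (fun p : ℝ × ℝ => f p.1 p.2) (Icc a b ×ˢ univ) →
      ∀ s ∈ Icc a b, Continuous (f s) := by
    intro f hf s hs
    rw [← continuousOn_univ]
    exact hf.comp (f := fun θ => (s, θ)) (by fun_prop) (fun θ _ => ⟨hs, mem_univ _⟩)
  -- Only first derivatives of the family are available, so the action is shown to have zero
  -- derivative in `s` through a remainder estimate, without a mixed second derivative.
  have key : ∀ s ∈ Icc a b,
      HasDerivWithinAt (fun s => loopAction (c s) (cθ s)) 0 (Icc a b) s := by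
    intro s₀ hs₀
    obtain ⟨M, hM⟩ := (isCompact_Icc (a := (0 : ℝ)) (b := 2 * Real.pi)).exists_bound_of_continuousOn
      (slice hcθ s₀ hs₀).continuousOn
    obtain ⟨N, hN⟩ := (isCompact_Icc (a := (0 : ℝ)) (b := 2 * Real.pi)).exists_bound_of_continuousOn
      (slice hcs s₀ hs₀).continuousOn
    have h0 : (0 : ℝ) ∈ Icc (0 : ℝ) (2 * Real.pi) := ⟨le_rfl, by positivity⟩
    have hM0 : 0 ≤ M := (norm_nonneg _).trans (hM 0 h0)
    have hN0 : 0 ≤ N := (norm_nonneg _).trans (hN 0 h0)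
    rw [hasDerivWithinAt_iff_isLittleO, Asymptotics.isLittleO_iff]
    intro η hη
    -- The two remainder terms are at most `2 M ε |s - s₀|` and `(1 + N) ε |s - s₀|`, integrated
    -- over length `2π`. The bound `ε ≤ 1` produces the `1` in `1 + N`.
    set C : ℝ := (2 * M + (1 + N)) * (2 * Real.pi) with hC
    have hCpos : 0 < C := by positivity
    set ε : ℝ := min 1 (η / C) with hε
    have hε0 : 0 < ε := lt_min one_pos (div_pos hη hCpos)
    obtain ⟨v₁, hv₁, hv₁'⟩ := (isCompact_Icc (a := (0 : ℝ)) (b := 2 * Real.pi)).mem_uniformity_of_prod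
      (f := cs) (s := Icc a b) (q := s₀) (hcs.mono (prod_mono_right (subset_univ _))) hs₀
      (Metric.dist_mem_uniformity hε0)
    obtain ⟨v₂, hv₂, hv₂'⟩ := (isCompact_Icc (a := (0 : ℝ)) (b := 2 * Real.pi)).mem_uniformity_of_prod
      (f := cθ) (s := Icc a b) (q := s₀) (hcθ.mono (prod_mono_right (subset_univ _))) hs₀
      (Metric.dist_mem_uniformity hε0)
    obtain ⟨δ, hδ, hδv⟩ := Metric.mem_nhdsWithin_iff.1 (inter_mem hv₁ hv₂)
    filter_upwards [self_mem_nhdsWithin, mem_nhdsWithin_of_mem_nhds (Metric.ball_mem_nhds s₀ hδ)]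
      with s hs' hsδ
    have hd : ∀ θ ∈ Icc (0 : ℝ) (2 * Real.pi),
        ‖c s θ - c s₀ θ - (s - s₀) • cs s₀ θ‖ ≤ ε * |s - s₀| := by
      intro θ hθ'
      have := Convex.norm_image_sub_le_of_norm_hasDerivWithin_le
        (f := fun x => c x θ - x • cs s₀ θ) (f' := fun x => cs x θ - (1 : ℝ) • cs s₀ θ) (C := ε)
        (s := Metric.ball s₀ δ ∩ Icc a b) (x := s₀) (y := s)
        (fun x hx => ((hs x hx.2 θ).mono inter_subset_right).sub
          ((hasDerivWithinAt_id x _).smul_const _))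
        (fun x hx => by
          have := hv₁' x (hδv hx).1 θ hθ'
          rw [one_smul, ← dist_eq_norm]
          exact this.le)
        ((convex_ball s₀ δ).inter (convex_Icc a b)) ⟨Metric.mem_ball_self hδ, hs₀⟩ ⟨hsδ, hs'⟩
      rw [Real.norm_eq_abs] at this
      rwa [sub_smul, show c s θ - c s₀ θ - (s • cs s₀ θ - s₀ • cs s₀ θ) =
        c s θ - s • cs s₀ θ - (c s₀ θ - s₀ • cs s₀ θ) by abel]
    have hd' : ∀ θ ∈ Icc (0 : ℝ) (2 * Real.pi), ‖cθ s θ - cθ s₀ θ‖ ≤ ε := by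
      intro θ hθ'
      rw [← dist_eq_norm]
      exact (hv₂' s (hδv ⟨hsδ, hs'⟩).2 θ hθ').le
    have hz : ∫ θ in (0 : ℝ)..(2 * Real.pi), symplecticL n ((s - s₀) • cs s₀ θ) (cθ s₀ θ) = 0 := by
      simp only [map_smul, smul_apply, smul_eq_mul]
      rw [intervalIntegral.integral_const_mul, harea s₀ hs₀, mul_zero]
    rw [smul_zero, sub_zero, loopAction_sub (hθ s₀ hs₀) (hθ s hs') (slice hcθ s₀ hs₀)
      (slice hcθ s hs') (hper s₀ hs₀) (hper s hs') ((slice hcs s₀ hs₀).const_smul (s - s₀)) hz]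
    have hbound := intervalIntegral.norm_integral_le_of_norm_le_const (a := (0 : ℝ))
      (b := 2 * Real.pi) (C := (2 * M + (1 + N)) * ε * |s - s₀|)
      (f := fun θ => 2 * symplecticL n (c s θ - c s₀ θ - (s - s₀) • cs s₀ θ) (cθ s₀ θ) +
            symplecticL n (c s θ - c s₀ θ) (cθ s θ - cθ s₀ θ)) (by
        intro θ hθ'
        rw [uIoc_of_le h0.2] at hθ'
        have hθI : θ ∈ Icc (0 : ℝ) (2 * Real.pi) := ⟨hθ'.1.le, hθ'.2⟩
        have e1 := hd θ hθI
        have e2 := hd' θ hθI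
        have e3 : ‖c s θ - c s₀ θ‖ ≤ (1 + N) * |s - s₀| := by
          calc ‖c s θ - c s₀ θ‖
              = ‖(c s θ - c s₀ θ - (s - s₀) • cs s₀ θ) + (s - s₀) • cs s₀ θ‖ := by
                rw [sub_add_cancel]
            _ ≤ ‖c s θ - c s₀ θ - (s - s₀) • cs s₀ θ‖ + ‖(s - s₀) • cs s₀ θ‖ := norm_add_le _ _
            _ ≤ 1 * |s - s₀| + N * |s - s₀| := by
                rw [norm_smul, Real.norm_eq_abs, mul_comm |s - s₀|]
                refine add_le_add (e1.trans ?_) ?_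
                · exact mul_le_mul_of_nonneg_right (min_le_left _ _) (abs_nonneg _)
                · exact mul_le_mul_of_nonneg_right (hN θ hθI) (abs_nonneg _)
            _ = (1 + N) * |s - s₀| := by ring
        calc _ ≤ 2 * (ε * |s - s₀| * M) + (1 + N) * |s - s₀| * ε := by
              refine (norm_add_le _ _).trans (add_le_add ?_ ?_)
              · rw [norm_mul, Real.norm_two]
                exact mul_le_mul_of_nonneg_left ((norm_symplecticL_le _ _).trans
                  (mul_le_mul e1 (hM θ hθI) (norm_nonneg _) (by positivity))) zero_le_two
              · exact (norm_symplecticL_le _ _).trans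
                  (mul_le_mul e3 e2 (norm_nonneg _) (by positivity))
          _ = _ := by ring)
    refine hbound.trans ?_
    rw [sub_zero, abs_of_nonneg h0.2, Real.norm_eq_abs]
    calc _ = ε * C * |s - s₀| := by rw [hC]; ring
      _ ≤ (η / C) * C * |s - s₀| := by gcongr; exact min_le_right _ _
      _ = η * |s - s₀| := by rw [div_mul_cancel₀ _ hCpos.ne']
  exact constant_of_has_deriv_right_zero (fun s hs => (key s hs).continuousWithinAt)
    (fun s hs => (key s ⟨hs.1, hs.2.le⟩).mono_of_mem_nhdsWithin
      (Icc_mem_nhdsGE_of_mem hs)) b ⟨hab, le_rfl⟩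
/-! ### Hamiltonian flows -/

/-- A smooth family of maps `ψ t`, `t ∈ [a, b]`, starting at the identity and generated by a smooth
time-dependent Hamiltonian. -/
structure IsHamiltonianFlowOn {n : ℕ} (a b : ℝ) (ψ : ℝ → Cn n → Cn n) (H : ℝ → Cn n → ℝ)
    (X : ℝ → Cn n → Cn n) : Prop where
  smooth : ContDiffOn ℝ ∞ (fun p : ℝ × Cn n => ψ p.1 p.2) (Icc a b ×ˢ univ)
  init : ∀ x, ψ a x = x
  smooth_ham : ContDiffOn ℝ ∞ (fun p : ℝ × Cn n => H p.1 p.2) (Icc a b ×ˢ univ)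
  ham : ∀ t ∈ Icc a b, IsHamiltonianVectorField (X t) (H t)
  deriv : ∀ t ∈ Icc a b, ∀ x, HasDerivWithinAt (fun s => ψ s x) (X t (ψ t x)) (Icc a b) t

/-! ### Space and time derivatives of maps smooth on a closed time interval. -/

section Slices

variable {E F : Type*} [NormedAddCommGroup E] [NormedSpace ℝ E] [NormedAddCommGroup F]
  [NormedSpace ℝ F] {a b : ℝ} {f : ℝ → E → F}

theorem ContDiffOn.contDiff_slice
    (hf : ContDiffOn ℝ ∞ (fun p : ℝ × E => f p.1 p.2) (Icc a b ×ˢ univ)) {t : ℝ}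
    (ht : t ∈ Icc a b) : ContDiff ℝ ∞ (f t) := by
  rw [← contDiffOn_univ]
  exact hf.comp (f := fun x => (t, x)) (by fun_prop) fun x _ => ⟨ht, mem_univ _⟩

theorem uniqueDiffOn_Icc_prod_univ (hab : a < b) :
    UniqueDiffOn ℝ (Icc a b ×ˢ (univ : Set E)) :=
  (uniqueDiffOn_Icc hab).prod uniqueDiffOn_univ

theorem ContDiffOn.hasFDerivWithinAt_prod
    (hf : ContDiffOn ℝ ∞ (fun p : ℝ × E => f p.1 p.2) (Icc a b ×ˢ univ)) {t : ℝ}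
    (ht : t ∈ Icc a b) (x : E) :
    HasFDerivWithinAt (fun p : ℝ × E => f p.1 p.2)
      (fderivWithin ℝ (fun p : ℝ × E => f p.1 p.2) (Icc a b ×ˢ univ) (t, x))
      (Icc a b ×ˢ univ) (t, x) :=
  (hf.differentiableOn (by simp) (t, x) ⟨ht, mem_univ _⟩).hasFDerivWithinAt

theorem ContDiffOn.continuousOn_fderivWithin_prod (hab : a < b)
    (hf : ContDiffOn ℝ ∞ (fun p : ℝ × E => f p.1 p.2) (Icc a b ×ˢ univ)) :
    ContinuousOn (fderivWithin ℝ (fun p : ℝ × E => f p.1 p.2) (Icc a b ×ˢ univ))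
      (Icc a b ×ˢ univ) :=
  hf.continuousOn_fderivWithin (uniqueDiffOn_Icc_prod_univ hab) (by simp)

theorem ContDiffOn.fderiv_slice
    (hf : ContDiffOn ℝ ∞ (fun p : ℝ × E => f p.1 p.2) (Icc a b ×ˢ univ)) {t : ℝ}
    (ht : t ∈ Icc a b) (x : E) :
    fderiv ℝ (f t) x =
      (fderivWithin ℝ (fun p : ℝ × E => f p.1 p.2) (Icc a b ×ˢ univ) (t, x)).comp
        (ContinuousLinearMap.inr ℝ ℝ E) := by
  have h := (hf.hasFDerivWithinAt_prod ht x).comp x (f := fun y => (t, y)) (s := univ)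
    (hasFDerivAt_prodMk_right t x).hasFDerivWithinAt (fun y _ => ⟨ht, mem_univ _⟩)
  rw [hasFDerivWithinAt_univ] at h
  exact h.fderiv

theorem ContDiffOn.continuousOn_fderiv_slice (hab : a < b)
    (hf : ContDiffOn ℝ ∞ (fun p : ℝ × E => f p.1 p.2) (Icc a b ×ˢ univ)) :
    ContinuousOn (fun p : ℝ × E => fderiv ℝ (f p.1) p.2) (Icc a b ×ˢ univ) := by
  refine ContinuousOn.congr (f := fun p => (fderivWithin ℝ (fun p : ℝ × E => f p.1 p.2)
    (Icc a b ×ˢ univ) p).comp (ContinuousLinearMap.inr ℝ ℝ E)) ?_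
    (fun p hp => hf.fderiv_slice hp.1 p.2)
  exact (hf.continuousOn_fderivWithin_prod hab).clm_comp continuousOn_const

theorem ContDiffOn.hasDerivWithinAt_slice
    (hf : ContDiffOn ℝ ∞ (fun p : ℝ × E => f p.1 p.2) (Icc a b ×ˢ univ)) {t : ℝ}
    (ht : t ∈ Icc a b) (x : E) :
    HasDerivWithinAt (fun s => f s x)
      (fderivWithin ℝ (fun p : ℝ × E => f p.1 p.2) (Icc a b ×ˢ univ) (t, x) (1, 0))
      (Icc a b) t :=
  (hf.hasFDerivWithinAt_prod ht x).comp_hasDerivWithinAt t (f := fun s => (s, x))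
    ((hasDerivWithinAt_id t _).prodMk (hasDerivWithinAt_const t _ x))
    (fun _ hs => ⟨hs, mem_univ _⟩)

end Slices

namespace IsHamiltonianFlowOn

variable {n : ℕ} {a b : ℝ} {ψ : ℝ → Cn n → Cn n} {H : ℝ → Cn n → ℝ} {X : ℝ → Cn n → Cn n}

/-- This is the source of continuity for `X` along the flow, as the structure asks for no regularity
of `X` itself. -/
theorem fderivWithin_time (hψ : IsHamiltonianFlowOn a b ψ H X) (hab : a < b) {t : ℝ}
    (ht : t ∈ Icc a b) (x : Cn n) :
    fderivWithin ℝ (fun p : ℝ × Cn n => ψ p.1 p.2) (Icc a b ×ˢ univ) (t, x) (1, 0) =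
      X t (ψ t x) :=
  (uniqueDiffOn_Icc hab t ht).eq_deriv _ (hψ.smooth.hasDerivWithinAt_slice ht x)
    (hψ.deriv t ht x)

/-- Hamiltonian flows preserve the action of loops. -/
theorem loopAction_comp (hψ : IsHamiltonianFlowOn a b ψ H X) (hab : a < b) {t : ℝ}
    (ht : t ∈ Icc a b) {l l' : ℝ → Cn n} (hl : ∀ θ, HasDerivAt l (l' θ) θ) (hl' : Continuous l')
    (hper : l (2 * Real.pi) = l 0) :
    loopAction (fun θ => ψ t (l θ)) (fun θ => fderiv ℝ (ψ t) (l θ) (l' θ)) = loopAction l l' := by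
  have hlc : Continuous l := continuous_iff_continuousAt.2 fun θ => (hl θ).continuousAt
  have hsub : Icc a t ×ˢ (univ : Set (Cn n)) ⊆ Icc a b ×ˢ univ :=
    prod_mono (Icc_subset_Icc_right ht.2) Subset.rfl
  have ha : a ∈ Icc a b := ⟨le_rfl, hab.le⟩
  have hsm : ∀ s ∈ Icc a b, ∀ x, HasFDerivAt (ψ s) (fderiv ℝ (ψ s) x) x := fun s hs x =>
    ((hψ.smooth.contDiff_slice hs).differentiable (by simp) x).hasFDerivAt
  have hcθ : ∀ s ∈ Icc a t, ∀ θ, HasDerivAt (fun θ => ψ s (l θ)) (fderiv ℝ (ψ s) (l θ) (l' θ)) θ :=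
    fun s hs θ => (hsm s ⟨hs.1, hs.2.trans ht.2⟩ _).comp_hasDerivAt θ (hl θ)
  have hcont : ContinuousOn (fun p : ℝ × ℝ => fderiv ℝ (ψ p.1) (l p.2) (l' p.2))
      (Icc a t ×ˢ univ) := by
    refine ContinuousOn.clm_apply ?_ (by fun_prop)
    exact (hψ.smooth.continuousOn_fderiv_slice hab).comp (f := fun p : ℝ × ℝ => (p.1, l p.2))
      (by fun_prop) (fun p hp => ⟨⟨hp.1.1, hp.1.2.trans ht.2⟩, mem_univ _⟩)
  have hXcont : ContinuousOn (fun p : ℝ × ℝ => X p.1 (ψ p.1 (l p.2))) (Icc a t ×ˢ univ) := by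
    refine ContinuousOn.congr (f := fun p : ℝ × ℝ => fderivWithin ℝ
      (fun p : ℝ × Cn n => ψ p.1 p.2) (Icc a b ×ˢ univ) (p.1, l p.2) (1, 0)) ?_
      (fun p hp => (hψ.fderivWithin_time hab ⟨hp.1.1, hp.1.2.trans ht.2⟩ _).symm)
    refine ContinuousOn.clm_apply ?_ continuousOn_const
    exact (hψ.smooth.continuousOn_fderivWithin_prod hab).comp
      (f := fun p : ℝ × ℝ => (p.1, l p.2))
      (by fun_prop) (fun p hp => ⟨⟨hp.1.1, hp.1.2.trans ht.2⟩, mem_univ _⟩)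
  rw [loopAction_eq_of_family ht.1 (c := fun s θ => ψ s (l θ))
    (cs := fun s θ => X s (ψ s (l θ))) (cθ := fun s θ => fderiv ℝ (ψ s) (l θ) (l' θ))
    (fun s hs θ => (hψ.deriv s ⟨hs.1, hs.2.trans ht.2⟩ _).mono (Icc_subset_Icc_right ht.2))
    hcθ hXcont hcont (fun s _ => by simp only [hper])]
  · have hid : ψ a = id := funext hψ.init
    simp [hid, loopAction]
  · intro s hs
    have hs' : s ∈ Icc a b := ⟨hs.1, hs.2.trans ht.2⟩
    have slice : ∀ {f : ℝ → ℝ → Cn n},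
        ContinuousOn (fun p : ℝ × ℝ => f p.1 p.2) (Icc a t ×ˢ univ) → Continuous (f s) := by
      intro f hf
      rw [← continuousOn_univ]
      exact hf.comp (f := fun θ => (s, θ)) (by fun_prop) (fun θ _ => ⟨hs, mem_univ _⟩)
    -- The area swept out is exact: `ω(X, ∂_θ c) = dH(∂_θ c)` is the derivative of `H` along a
    -- closed loop.
    refine integral_deriv_loop (f := fun θ => H s (ψ s (l θ))) (fun θ => ?_)
      (continuous_symplecticL (slice (f := fun s θ => X s (ψ s (l θ))) hXcont)
        (slice (f := fun s θ => fderiv ℝ (ψ s) (l θ) (l' θ)) hcont)) (by simp only [hper])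
    rw [symplecticL_apply, hψ.ham s hs']
    exact (((hψ.smooth_ham.contDiff_slice hs').differentiable (by simp)
      (ψ s (l θ))).hasFDerivAt.comp_hasDerivAt θ (hcθ s hs θ))

/-- Hamiltonian flows consist of symplectic maps. -/
theorem symplectic (hψ : IsHamiltonianFlowOn a b ψ H X) (hab : a < b) {t : ℝ}
    (ht : t ∈ Icc a b) (z u v : Cn n) :
    symplecticL n (fderiv ℝ (ψ t) z u) (fderiv ℝ (ψ t) z v) = symplecticL n u v := by
  set s : Set (ℝ × Cn n) := Icc a b ×ˢ univ with hs
  set F : ℝ × Cn n → Cn n := fun p => ψ p.1 p.2 with hF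
  set F' := fderivWithin ℝ F s with hF'
  have hus : UniqueDiffOn ℝ s := uniqueDiffOn_Icc_prod_univ hab
  have hF'smooth : ContDiffOn ℝ ∞ F' s := hψ.smooth.fderivWithin hus (by simp)
  have hF'd : ∀ r ∈ Icc a b, HasFDerivWithinAt F' (fderivWithin ℝ F' s (r, z)) s (r, z) :=
    fun r hr => (hF'smooth.differentiableOn (by simp) (r, z) ⟨hr, mem_univ _⟩).hasFDerivWithinAt
  -- Mixed second derivatives commute at the end times too, because every point of `[a, b] × ℂⁿ`
  -- lies in the closure of the interior.
  have hsymm : ∀ r ∈ Icc a b, ∀ w, fderivWithin ℝ F' s (r, z) (1, 0) (0, w) =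
      fderivWithin ℝ F' s (r, z) (0, w) (1, 0) := by
    intro r hr w
    refine (ContDiffWithinAt.isSymmSndFDerivWithinAt (hψ.smooth (r, z) ⟨hr, mem_univ _⟩)
      ?_ hus ?_ ⟨hr, mem_univ _⟩).eq _ _
    · simpa using WithTop.coe_le_coe.2 (le_top : (2 : ℕ∞) ≤ ⊤)
    · rw [interior_prod_eq, interior_univ, interior_Icc, closure_prod_eq, closure_univ,
        closure_Ioo hab.ne]
      exact ⟨hr, mem_univ _⟩
  have hsl : ∀ r ∈ Icc a b, ∀ w, fderiv ℝ (ψ r) z w = F' (r, z) (0, w) := by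
    intro r hr w
    rw [hψ.smooth.fderiv_slice hr z]
    rfl
  -- Differentiating `ω(X_r ∘ ψ_r, y) = dH_r(ψ_r) y` in space gives the linearised flow equation.
  -- Symmetry of the Hessian of `H_r` then makes the derivative of `ω(dψ u, dψ v)` vanish.
  have hHess : ∀ r ∈ Icc a b, ∀ w y, symplecticL n (fderivWithin ℝ F' s (r, z) (0, w) (1, 0)) y =
      fderiv ℝ (fderiv ℝ (H r)) (ψ r z) (F' (r, z) (0, w)) y := by
    intro r hr w y
    have hHr := hψ.smooth_ham.contDiff_slice hr
    have e1 : HasFDerivAt (fun x => symplecticL n (F' (r, x) (1, 0)) y)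
        (((symplecticL n).flip y).comp (((ContinuousLinearMap.apply ℝ (Cn n) ((1, 0) : ℝ × Cn n)).comp
          (fderivWithin ℝ F' s (r, z))).comp (ContinuousLinearMap.inr ℝ ℝ (Cn n)))) z := by
      have := (hF'd r hr).comp z (f := fun y => (r, y)) (s := univ)
        (hasFDerivAt_prodMk_right r z).hasFDerivWithinAt (fun y _ => ⟨hr, mem_univ _⟩)
      rw [hasFDerivWithinAt_univ] at this
      exact ((symplecticL n).flip y).hasFDerivAt.comp z
        ((ContinuousLinearMap.apply ℝ (Cn n) ((1, 0) : ℝ × Cn n)).hasFDerivAt.comp z this)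
    have e2 : HasFDerivAt (fun x => fderiv ℝ (H r) (ψ r x) y)
        ((ContinuousLinearMap.apply ℝ ℝ y).comp
          ((fderiv ℝ (fderiv ℝ (H r)) (ψ r z)).comp (fderiv ℝ (ψ r) z))) z := by
      have h1 : HasFDerivAt (fderiv ℝ (H r)) (fderiv ℝ (fderiv ℝ (H r)) (ψ r z)) (ψ r z) :=
        ((hHr.fderiv_right (m := ∞) (by simp)).differentiable (by simp) _).hasFDerivAt
      have h2 : HasFDerivAt (ψ r) (fderiv ℝ (ψ r) z) z :=
        ((hψ.smooth.contDiff_slice hr).differentiable (by simp) z).hasFDerivAt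
      exact (ContinuousLinearMap.apply ℝ ℝ y).hasFDerivAt.comp z (h1.comp z h2)
    have e3 : (fun x => symplecticL n (F' (r, x) (1, 0)) y) =
        fun x => fderiv ℝ (H r) (ψ r x) y := by
      funext x
      rw [hF', hψ.fderivWithin_time hab hr, symplecticL_apply, hψ.ham r hr]
    rw [e3] at e1
    have := congrArg (fun L => L w) (e1.unique e2)
    simpa [hsl r hr] using this
  have hder : ∀ r ∈ Icc a b, ∀ w, HasDerivWithinAt (fun r => F' (r, z) (0, w))
      (fderivWithin ℝ F' s (r, z) (0, w) (1, 0)) (Icc a b) r := by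
    intro r hr w
    rw [← hsymm r hr]
    exact ((hF'd r hr).comp_hasDerivWithinAt r (f := fun s => (s, z))
      ((hasDerivWithinAt_id r _).prodMk (hasDerivWithinAt_const r _ z))
      (fun s hs => ⟨hs, mem_univ _⟩)).clm_apply (hasDerivWithinAt_const r _ ((0, w) : ℝ × Cn n))
      |>.congr_deriv (by simp)
  have key : ∀ r ∈ Icc a b, HasDerivWithinAt
      (fun r => symplecticL n (F' (r, z) (0, u)) (F' (r, z) (0, v))) 0 (Icc a b) r := by
    intro r hr
    have := ((symplecticL n).hasFDerivAt.comp_hasDerivWithinAt r (hder r hr u)).clm_apply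
      (hder r hr v)
    refine this.congr_deriv ?_
    rw [hHess r hr, Function.comp_apply, symplecticL_antisymm, hHess r hr]
    have hsy := (((hψ.smooth_ham.contDiff_slice hr).contDiffAt (x := ψ r z)).isSymmSndFDerivAt
      (by simpa using WithTop.coe_le_coe.2 (le_top : (2 : ℕ∞) ≤ ⊤))).eq (F' (r, z) (0, u)) (F' (r, z) (0, v))
    rw [hsy]
    ring
  have hconst := constant_of_has_deriv_right_zero (fun r hr => (key r hr).continuousWithinAt)
    (fun r hr => (key r ⟨hr.1, hr.2.le⟩).mono_of_mem_nhdsWithin (Icc_mem_nhdsGE_of_mem hr)) t ht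
  rw [hsl t ht, hsl t ht, hconst, ← hsl a ⟨le_rfl, hab.le⟩, ← hsl a ⟨le_rfl, hab.le⟩,
    show ψ a = id from funext hψ.init]
  simp

end IsHamiltonianFlowOn

/-- Symplectic diffeomorphisms map closed Lagrangian submanifolds to such. -/
theorem IsClosedLagrangian.image {n : ℕ} {S : Set (Cn n)} (hS : IsClosedLagrangian S)
    (e : Cn n ≃ₜ Cn n) (he : ContDiff ℝ ∞ e) (he' : ContDiff ℝ ∞ e.symm)
    (hsymp : ∀ z u v, symplecticL n (fderiv ℝ e z u) (fderiv ℝ e z v) = symplecticL n u v) :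
    IsClosedLagrangian (e '' S) where
  isCompact := hS.isCompact.image e.continuous
  submanifold := by
    rintro _ ⟨x, hx, rfl⟩
    obtain ⟨Φ, hxs, h1, h2, h3⟩ := hS.submanifold x hx
    refine ⟨e.symm.transOpenPartialHomeomorph Φ, ?_, ?_, ?_, ?_⟩
    · simpa using hxs
    · exact h1.comp he'.contDiffOn (fun y hy => hy)
    · exact he.comp_contDiffOn h2
    · intro y hy
      have : y ∈ e '' S ↔ e.symm y ∈ S := by
        constructor
        · rintro ⟨x, hx, rfl⟩
          simpa using hx
        · exact fun h => ⟨_, h, by simp⟩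
      rw [this]
      exact h3 (e.symm y) hy
  isotropic := by
    have pull : ∀ x ∈ S, ∀ w ∈ tangentVectors (e '' S) (e x),
        ∃ w' ∈ tangentVectors S x, w = fderiv ℝ e x w' := by
      rintro x hx w ⟨γ, h0, hγ, hd⟩
      have hc : HasDerivAt (fun s => e.symm (γ s)) (fderiv ℝ e.symm (γ 0) w) 0 :=
        ((he'.differentiable (by simp)) (γ 0)).hasFDerivAt.comp_hasDerivAt 0 hd
      refine ⟨_, ⟨fun s => e.symm (γ s), by simp [h0], ?_, hc⟩, ?_⟩
      · filter_upwards [hγ] with s hs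
        obtain ⟨y, hy, hys⟩ := hs
        rw [← hys]
        simpa using hy
      · have h2 : HasFDerivAt e (fderiv ℝ e x) (e.symm (γ 0)) := by
          rw [h0, e.symm_apply_apply]
          exact ((he.differentiable (by simp)) x).hasFDerivAt
        have h3 := h2.comp_hasDerivAt 0 hc
        refine hd.unique (h3.congr_of_eventuallyEq ?_)
        exact Eventually.of_forall fun s => (e.apply_symm_apply _).symm
    rintro _ ⟨x, hx, rfl⟩ u hu v hv
    obtain ⟨u₁, hu₁, rfl⟩ := pull x hx u hu
    obtain ⟨v₁, hv₁, rfl⟩ := pull x hx v hv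
    rw [← symplecticL_apply, hsymp]
    exact hS.isotropic x hx u₁ hu₁ v₁ hv₁
/-! ### Lagrangian submanifolds of the sphere are invariant under the Hopf flow -/

/-- A local parametrisation of `S` near `p`: on the ball of radius `r` around `x₀` the map `χ` is a
smooth immersion into `S`, and `κ` is a local inverse on `S`. -/
structure IsLocalParam {n : ℕ} (S : Set (Cn n)) (p : Cn n) (χ : Rn n → Cn n) (κ : Cn n → Rn n)
    (x₀ : Rn n) (r : ℝ) : Prop where
  pos : 0 < r
  smooth : ContDiffOn ℝ ∞ χ (Metric.ball x₀ r)
  mem : ∀ x ∈ Metric.ball x₀ r, χ x ∈ S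
  inj : ∀ x ∈ Metric.ball x₀ r, Function.Injective (fderiv ℝ χ x)
  map : χ x₀ = p
  inv_map : κ p = x₀
  cont : ContinuousAt κ p
  right_inv : ∀ᶠ q in 𝓝[S] p, χ (κ q) = q

/-- The derivative identity serves twice: it makes the slice parametrisation an immersion, and it
shows that vectors tangent to the slice have zero second chart component. -/
theorem slice_of_chart {n : ℕ} {S : Set (Cn n)} {Φ : OpenPartialHomeomorph (Cn n) (Rn n × Rn n)}
    (h1 : ContDiffOn ℝ ∞ Φ Φ.source) (h2 : ContDiffOn ℝ ∞ Φ.symm Φ.target)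
    (h3 : ∀ y ∈ Φ.source, y ∈ S ↔ (Φ y).2 = 0) {x : Rn n}
    (hx : (x, (0 : Rn n)) ∈ Φ.target) :
    Φ.symm (x, 0) ∈ S ∧ ContDiffAt ℝ ∞ (fun x : Rn n => Φ.symm (x, 0)) x ∧
      ∀ v, fderiv ℝ Φ (Φ.symm (x, 0)) (fderiv ℝ (fun x : Rn n => Φ.symm (x, 0)) x v) = (v, 0) := by
  have hsrc : Φ.symm (x, 0) ∈ Φ.source := Φ.map_target hx
  have hχ : ContDiffAt ℝ ∞ (fun x : Rn n => Φ.symm (x, 0)) x :=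
    (h2.contDiffAt (Φ.open_target.mem_nhds hx)).comp x (f := fun x : Rn n => (x, (0 : Rn n)))
      (by fun_prop)
  refine ⟨?_, hχ, fun v => ?_⟩
  · rw [h3 _ hsrc, Φ.right_inv hx]
  · have e1 : HasFDerivAt Φ (fderiv ℝ Φ (Φ.symm (x, 0))) (Φ.symm (x, 0)) :=
      ((h1.contDiffAt (Φ.open_source.mem_nhds hsrc)).differentiableAt (by simp)).hasFDerivAt
    have e2 := e1.comp x (hχ.differentiableAt (by simp)).hasFDerivAt
    have e3 : HasFDerivAt (Φ ∘ fun x : Rn n => Φ.symm (x, 0))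
        (ContinuousLinearMap.inl ℝ (Rn n) (Rn n)) x := by
      refine (hasFDerivAt_prodMk_left x (0 : Rn n)).congr_of_eventuallyEq ?_
      have : ∀ᶠ y : Rn n in 𝓝 x, (y, (0 : Rn n)) ∈ Φ.target :=
        (Continuous.prodMk_left (0 : Rn n)).continuousAt.preimage_mem_nhds
          (Φ.open_target.mem_nhds hx)
      filter_upwards [this] with y hy
      exact Φ.right_inv hy
    have := congrArg (fun L => L v) (e2.unique e3)
    simpa using this

theorem IsHalfDimSubmanifold.exists_isLocalParam {n : ℕ} {S : Set (Cn n)}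
    (hS : IsHalfDimSubmanifold S) {p : Cn n} (hp : p ∈ S) :
    ∃ χ κ x₀ r, IsLocalParam S p χ κ x₀ r := by
  obtain ⟨Φ, hps, h1, h2, h3⟩ := hS p hp
  have hΦp : ((Φ p).1, (0 : Rn n)) = Φ p := by
    rw [← (h3 p hps).1 hp]
  have hev : ∀ᶠ y : Rn n in 𝓝 (Φ p).1, (y, (0 : Rn n)) ∈ Φ.target :=
    (Continuous.prodMk_left (0 : Rn n)).continuousAt.preimage_mem_nhds
      (Φ.open_target.mem_nhds (by simpa only [hΦp] using Φ.map_source hps))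
  obtain ⟨r, hr, hball⟩ := Metric.eventually_nhds_iff_ball.1 hev
  refine ⟨fun x => Φ.symm (x, 0), fun q => (Φ q).1, (Φ p).1, r, hr, ?_, ?_, ?_, ?_, rfl, ?_, ?_⟩
  · exact fun x hx => (slice_of_chart h1 h2 h3 (hball x hx)).2.1.contDiffWithinAt
  · exact fun x hx => (slice_of_chart h1 h2 h3 (hball x hx)).1
  · intro x hx u v huv
    have h := (slice_of_chart h1 h2 h3 (hball x hx)).2.2
    have := h u
    rw [huv, h v] at this
    exact (congrArg Prod.fst this).symm
  · simp only [hΦp]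
    exact Φ.left_inv hps
  · exact continuous_fst.continuousAt.comp (Φ.continuousAt hps)
  · filter_upwards [self_mem_nhdsWithin,
      mem_nhdsWithin_of_mem_nhds (Φ.open_source.mem_nhds hps)] with q hq hqs
    have : ((Φ q).1, (0 : Rn n)) = Φ q := by
      rw [← (h3 q hqs).1 hq]
    simp only [this]
    exact Φ.left_inv hqs

theorem mem_tangentVectors_of_hasFDerivAt {n : ℕ} {S : Set (Cn n)} {χ : Rn n → Cn n} {x : Rn n}
    {D : Rn n →L[ℝ] Cn n} (hD : HasFDerivAt χ D x) (hS : ∀ᶠ y in 𝓝 x, χ y ∈ S) (v : Rn n) :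
    D v ∈ tangentVectors S (χ x) := by
  have hl : HasDerivAt (fun s : ℝ => x + s • v) v 0 := by
    simpa using ((hasDerivAt_id (0 : ℝ)).smul_const v).const_add x
  refine ⟨fun s => χ (x + s • v), by simp, ?_, ?_⟩
  · have : Tendsto (fun s : ℝ => x + s • v) (𝓝 0) (𝓝 x) := by
      simpa using hl.continuousAt.tendsto
    exact this.eventually hS
  · exact HasFDerivAt.comp_hasDerivAt (0 : ℝ) (by simpa using hD) hl

/-- A submanifold of the sphere is orthogonal to the position vector. -/
theorem inner_tangentVectors_sphere {n : ℕ} {S : Set (Cn n)}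
    (hsph : S ⊆ Metric.sphere (0 : Cn n) 1) {z w : Cn n}
    (hw : w ∈ tangentVectors S z) : symplecticL n z (Complex.I • w) = 0 := by
  obtain ⟨γ, h0, hγ, hd⟩ := hw
  have h1 : HasDerivAt (fun s => symplecticL n (γ s) (Complex.I • γ s))
      (symplecticL n w (Complex.I • γ 0) + symplecticL n (γ 0) (Complex.I • w)) 0 :=
    hasDerivAt_symplecticL hd (hd.const_smul Complex.I)
  have h2 : HasDerivAt (fun s => symplecticL n (γ s) (Complex.I • γ s)) 0 0 := by
    refine (hasDerivAt_const (0 : ℝ) (1 : ℝ)).congr_of_eventuallyEq ?_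
    filter_upwards [hγ] with s hs
    rw [symplecticL_self_I, mem_sphere_zero_iff_norm.1 (hsph hs), one_pow]
  have h3 := h1.unique h2
  rw [h0, symplecticL_I_right_comm w z] at h3
  linarith

/-- The position vector is orthogonal to the tangent space `T`, hence lies in `i T`; multiplying by
`i` puts the Hopf direction into `T`. -/
theorem exists_eq_I_smul_tangent {n : ℕ} {S : Set (Cn n)} (hS : IsClosedLagrangian S)
    (hsph : S ⊆ Metric.sphere (0 : Cn n) 1) {χ : Rn n → Cn n} {x : Rn n}
    {D : Rn n →L[ℝ] Cn n} (hD : HasFDerivAt χ D x) (hχ : ∀ᶠ y in 𝓝 x, χ y ∈ S)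
    (hinj : Function.Injective D) : ∃ v, Complex.I • χ x = D v := by
  have ht := mem_tangentVectors_of_hasFDerivAt hD hχ
  obtain ⟨w, hw⟩ := exists_eq_I_smul_of_orthogonal hinj
    (fun u v => hS.isotropic _ hχ.self_of_nhds _ (ht u) _ (ht v))
    (fun v => inner_tangentVectors_sphere hsph (ht v))
  refine ⟨-w, ?_⟩
  rw [hw, smul_smul, Complex.I_mul_I, map_neg, neg_smul, one_smul]

/-- The Hopf flow. -/
noncomputable def hopf {n : ℕ} (θ : ℝ) (z : Cn n) : Cn n := Complex.exp (θ * Complex.I) • z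

theorem norm_exp_hopf (θ : ℝ) : ‖Complex.exp (θ * Complex.I)‖ = 1 :=
  Complex.norm_exp_ofReal_mul_I θ

theorem hasDerivAt_exp_hopf (θ : ℝ) :
    HasDerivAt (fun θ : ℝ => Complex.exp (θ * Complex.I))
      (Complex.exp (θ * Complex.I) * Complex.I) θ := by
  have h : HasDerivAt (fun θ : ℝ => (θ : ℂ) * Complex.I) Complex.I θ := by
    simpa using (Complex.ofRealCLM.hasDerivAt (x := θ)).mul_const Complex.I
  exact h.cexp

theorem hasDerivAt_hopf {n : ℕ} {c : ℝ → Cn n} {c' : Cn n} {θ : ℝ} (hc : HasDerivAt c c' θ) :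
    HasDerivAt (fun θ => hopf θ (c θ)) (hopf θ (Complex.I • c θ + c')) θ := by
  have := (hasDerivAt_exp_hopf θ).smul hc
  refine this.congr_deriv ?_
  rw [hopf, smul_add, smul_smul, add_comm]

theorem hopf_zero {n : ℕ} (z : Cn n) : hopf 0 z = z := by simp [hopf]

theorem hopf_add {n : ℕ} (s t : ℝ) (z : Cn n) : hopf (s + t) z = hopf s (hopf t z) := by
  simp [hopf, smul_smul, ← Complex.exp_add, add_mul]

theorem hopf_two_pi {n : ℕ} (z : Cn n) : hopf (2 * Real.pi) z = z := by
  simp [hopf]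

theorem continuous_hopf {n : ℕ} (z : Cn n) : Continuous fun θ => hopf θ z := by
  unfold hopf
  fun_prop

/-- In a slice chart the normal component `u` of a Hopf orbit satisfies `|u'| ≤ K |u|`, since the
Hopf field has Lipschitz normal part `G` vanishing on the slice. Grönwall's inequality with `u(0) =
0` gives `u = 0`. -/
theorem IsClosedLagrangian.hopf_mem_of_small {n : ℕ} {S : Set (Cn n)} (hS : IsClosedLagrangian S)
    (hsph : S ⊆ Metric.sphere (0 : Cn n) 1) {p : Cn n} (hp : p ∈ S) :
    ∃ ε > 0, ∀ θ ∈ Icc 0 ε, hopf θ p ∈ S := by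
  obtain ⟨Φ, hps, h1, h2, h3⟩ := hS.submanifold p hp
  have hev : ∀ x : Rn n, (x, (0 : Rn n)) ∈ Φ.target → ∀ᶠ y : Rn n in 𝓝 x, Φ.symm (y, 0) ∈ S := by
    intro x hx
    have : ∀ᶠ y : Rn n in 𝓝 x, (y, (0 : Rn n)) ∈ Φ.target :=
      (Continuous.prodMk_left (0 : Rn n)).continuousAt.preimage_mem_nhds
        (Φ.open_target.mem_nhds hx)
    filter_upwards [this] with y hy using (slice_of_chart h1 h2 h3 hy).1
  set G : Rn n × Rn n → Rn n := fun w => (fderiv ℝ Φ (Φ.symm w) (Complex.I • Φ.symm w)).2 with hG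
  have hG0 : ∀ x : Rn n, (x, (0 : Rn n)) ∈ Φ.target → G (x, 0) = 0 := by
    intro x hx
    obtain ⟨-, hc, hd⟩ := slice_of_chart h1 h2 h3 hx
    obtain ⟨v, hv⟩ := exists_eq_I_smul_tangent hS hsph
      (hc.differentiableAt (by simp)).hasFDerivAt (hev x hx) (fun u v huv => by
        have := hd u
        rw [huv, hd v] at this
        exact (congrArg Prod.fst this).symm)
    simp only [hG]
    rw [hv, hd v]
  have hGs : ContDiffAt ℝ 1 G (Φ p) := by
    have e1 : ContDiffAt ℝ 1 Φ.symm (Φ p) :=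
      (h2.contDiffAt (Φ.open_target.mem_nhds (Φ.map_source hps))).of_le (by exact_mod_cast le_top)
    have e2 : ContDiffAt ℝ 1 (fderiv ℝ Φ) (Φ.symm (Φ p)) := by
      rw [Φ.left_inv hps]
      exact (h1.contDiffAt (Φ.open_source.mem_nhds hps)).fderiv_right (WithTop.coe_le_coe.2 (le_top : (1 + 1 : ℕ∞) ≤ ⊤))
    exact contDiff_snd.contDiffAt.comp _ ((e2.comp _ e1).clm_apply (e1.const_smul Complex.I))
  obtain ⟨K, t, ht, hK⟩ := hGs.exists_lipschitzOnWith
  obtain ⟨ρ, hρ, hball⟩ := Metric.mem_nhds_iff.1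
    (inter_mem ht (Φ.open_target.mem_nhds (Φ.map_source hps)))
  have hz : Continuous fun θ : ℝ => hopf θ p := continuous_hopf p
  have hnear : ∀ᶠ θ in 𝓝 (0 : ℝ), hopf θ p ∈ Φ.source ∧ Φ (hopf θ p) ∈ Metric.ball (Φ p) ρ := by
    have hz0 : Tendsto (fun θ : ℝ => hopf θ p) (𝓝 0) (𝓝 p) := by
      simpa [hopf_zero] using hz.tendsto 0
    exact (hz0.eventually (Φ.open_source.mem_nhds hps)).and
      (((Φ.continuousAt hps).tendsto.comp hz0).eventually (Metric.ball_mem_nhds _ hρ))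
  obtain ⟨ε, hε, hεn⟩ := Metric.eventually_nhds_iff_ball.1 hnear
  refine ⟨ε / 2, half_pos hε, fun θ hθ => ?_⟩
  have hIcc : ∀ θ ∈ Icc 0 (ε / 2), θ ∈ Metric.ball (0 : ℝ) ε := by
    intro θ hθ
    rw [mem_ball_zero_iff, Real.norm_eq_abs, abs_of_nonneg hθ.1]
    linarith [hθ.2]
  have hder : ∀ θ ∈ Icc 0 (ε / 2),
      HasDerivAt (fun θ => (Φ (hopf θ p)).2) (G (Φ (hopf θ p))) θ := by
    intro θ hθ
    obtain ⟨hs, -⟩ := hεn θ (hIcc θ hθ)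
    have e1 : HasFDerivAt Φ (fderiv ℝ Φ (hopf θ p)) (hopf θ p) :=
      ((h1.contDiffAt (Φ.open_source.mem_nhds hs)).differentiableAt (by simp)).hasFDerivAt
    have e2 : HasDerivAt (fun θ => hopf θ p) (Complex.I • hopf θ p) θ := by
      refine (hasDerivAt_hopf (hasDerivAt_const θ p)).congr_deriv ?_
      simp [hopf, smul_smul, mul_comm]
    have e3 := hasFDerivAt_snd.comp_hasDerivAt θ (e1.comp_hasDerivAt θ e2)
      (f := fun θ => Φ (hopf θ p))
    simp only [hG]
    rw [Φ.left_inv hs]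
    exact e3
  have hΦp : (Φ p).2 = 0 := (h3 p hps).1 hp
  rw [h3 _ (hεn θ (hIcc θ hθ)).1]
  refine eq_zero_of_abs_deriv_le_mul_abs_self_of_eq_zero_right (K := K)
    (fun θ hθ => (hder θ hθ).continuousAt.continuousWithinAt)
    (fun θ hθ => (hder θ ⟨hθ.1, hθ.2.le⟩).hasDerivWithinAt) ?_ ?_ θ hθ
  · rw [hopf_zero, hΦp]
  · intro θ hθ
    have hw := (hεn θ (hIcc θ ⟨hθ.1, hθ.2.le⟩)).2
    set w := Φ (hopf θ p)
    -- The projection of `w` to the slice stays in the ball, and its distance to `w` is exactly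
    -- `‖w.2‖`.
    have hw0 : (w.1, (0 : Rn n)) ∈ Metric.ball (Φ p) ρ := by
      rw [Metric.mem_ball, Prod.dist_eq, hΦp, dist_self, max_eq_left dist_nonneg]
      exact lt_of_le_of_lt (le_max_left _ _) (Metric.mem_ball.1 hw)
    have := hK.dist_le_mul w (hball hw).1 _ (hball hw0).1
    rw [hG0 _ (hball hw0).2, dist_zero_right, Prod.dist_eq, dist_self,
      max_eq_right dist_nonneg, dist_zero_right] at this
    exact this

/-- A closed Lagrangian submanifold of the unit sphere is a union of Hopf circles. -/
theorem IsClosedLagrangian.hopf_mem {n : ℕ} {S : Set (Cn n)} (hS : IsClosedLagrangian S)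
    (hsph : S ⊆ Metric.sphere (0 : Cn n) 1) {p : Cn n} (hp : p ∈ S) (θ : ℝ) : hopf θ p ∈ S := by
  have nonneg : ∀ θ : ℝ, 0 ≤ θ → hopf θ p ∈ S := by
    intro θ hθ
    have hsub : Icc 0 θ ⊆ (fun θ => hopf θ p) ⁻¹' S := by
      refine IsClosed.Icc_subset_of_forall_exists_gt
        ((hS.isCompact.isClosed.preimage (continuous_hopf p)).inter isClosed_Icc)
        (by simpa [hopf_zero] using hp) ?_
      intro x hx y hy
      obtain ⟨ε, hε, h⟩ := hS.hopf_mem_of_small hsph hx.1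
      refine ⟨x + min ε (y - x), ?_, ?_, ?_⟩
      · rw [mem_preimage, add_comm, hopf_add]
        exact h _ ⟨le_min hε.le (sub_nonneg.2 (le_of_lt hy)), min_le_left _ _⟩
      · exact lt_add_of_pos_right _ (lt_min hε (sub_pos.2 hy))
      · linarith [min_le_right ε (y - x)]
    exact hsub ⟨hθ, le_rfl⟩
  obtain ⟨k, hk⟩ := exists_nat_ge (-θ / (2 * Real.pi))
  have hkθ : 0 ≤ θ + k * (2 * Real.pi) := by
    rw [div_le_iff₀ Real.two_pi_pos] at hk
    linarith
  have hper : hopf (θ + k * (2 * Real.pi)) p = hopf θ p := by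
    have := (Complex.exp_mul_I_periodic.nat_mul k) (θ : ℂ)
    simp only [hopf]
    push_cast
    rw [this]
  rw [← hper]
  exact nonneg _ hkθ
/-! ### A uniform periodic implicit function theorem -/

theorem approximatesLinearOn_of_norm_fderiv_sub_le {E F : Type*} [NormedAddCommGroup E]
    [NormedSpace ℝ E] [NormedAddCommGroup F] [NormedSpace ℝ F] {f : E → F} {B : E →L[ℝ] F}
    {s : Set E} {c : NNReal} (hs : Convex ℝ s) (hf : ∀ x ∈ s, DifferentiableAt ℝ f x)
    (hB : ∀ x ∈ s, ‖fderiv ℝ f x - B‖ ≤ c) : ApproximatesLinearOn f B s c :=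
  fun _ hx _ hy => hs.norm_image_sub_le_of_norm_fderiv_le' hf hB hy hx

/-- A linear `M` is approximated by `B` on the whole space with constant `c < ‖B⁻¹‖⁻¹`, so the
quantitative inverse function theorem yields global bijectivity. -/
theorem ContinuousLinearMap.isInvertible_of_norm_sub_lt {E F : Type*} [NormedAddCommGroup E]
    [NormedSpace ℝ E] [CompleteSpace E] [NormedAddCommGroup F] [NormedSpace ℝ F] [CompleteSpace F]
    {M : E →L[ℝ] F} (B : E ≃L[ℝ] F) {c : NNReal} (hc : c < ‖(B.symm : F →L[ℝ] E)‖₊⁻¹)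
    (hM : ‖M - B‖ ≤ c) : M.IsInvertible := by
  have h : ApproximatesLinearOn M (B : E →L[ℝ] F) univ c :=
    approximatesLinearOn_of_norm_fderiv_sub_le convex_univ (fun x _ => M.differentiableAt)
      (fun x _ => by rwa [M.fderiv])
  have hinj : Function.Injective M := injOn_univ.1 (h.injOn (Or.inr hc))
  exact ⟨ContinuousLinearEquiv.ofBijective M (LinearMap.ker_eq_bot.2 hinj)
    (LinearMap.range_eq_top.2 (h.surjective (Or.inr hc))),
    ContinuousLinearEquiv.coe_ofBijective _ _ _⟩

/-- A global implicit function theorem, uniform in a real parameter. -/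
theorem exists_contDiff_implicit {E F : Type*} [NormedAddCommGroup E]
    [NormedSpace ℝ E] [CompleteSpace E] [NormedAddCommGroup F] [NormedSpace ℝ F] [CompleteSpace F]
    {f : ℝ → E → F} {x₀ : E} {r : ℝ} (hr : 0 < r)
    (hf : ContDiffOn ℝ 1 (fun p : ℝ × E => f p.1 p.2) (univ ×ˢ Metric.ball x₀ r))
    (B : E ≃L[ℝ] F) {c : NNReal} (hc : c < ‖(B.symm : F →L[ℝ] E)‖₊⁻¹)
    (hB : ∀ θ, ∀ x ∈ Metric.ball x₀ r, ‖fderiv ℝ (f θ) x - B‖ ≤ c)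
    (hsmall : ∀ θ, ‖f θ x₀‖ ≤ (‖(B.symm : F →L[ℝ] E)‖⁻¹ - c) * (r / 2)) :
    ∃ x : ℝ → E, ContDiff ℝ 1 x ∧ (∀ θ, x θ ∈ Metric.ball x₀ r) ∧ (∀ θ, f θ (x θ) = 0) ∧
      ∀ θ, ∀ y ∈ Metric.ball x₀ r, f θ y = 0 → y = x θ := by
  have hopen : IsOpen ((univ : Set ℝ) ×ˢ Metric.ball x₀ r) := isOpen_univ.prod Metric.isOpen_ball
  have hfat : ∀ θ, ∀ x ∈ Metric.ball x₀ r, ContDiffAt ℝ 1 (fun p : ℝ × E => f p.1 p.2) (θ, x) :=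
    fun θ x hx => hf.contDiffAt (hopen.mem_nhds ⟨mem_univ _, hx⟩)
  have hfθ : ∀ θ, ∀ x ∈ Metric.ball x₀ r, HasFDerivAt (f θ)
      ((fderiv ℝ (fun p : ℝ × E => f p.1 p.2) (θ, x)).comp (ContinuousLinearMap.inr ℝ ℝ E)) x :=
    fun θ x hx => ((hfat θ x hx).differentiableAt one_ne_zero).hasFDerivAt.comp x
      (hasFDerivAt_prodMk_right θ x)
  have happ : ∀ θ, ApproximatesLinearOn (f θ) (B : E →L[ℝ] F) (Metric.ball x₀ r) c := fun θ =>
    approximatesLinearOn_of_norm_fderiv_sub_le (convex_ball _ _)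
      (fun x hx => (hfθ θ x hx).differentiableAt) (hB θ)
  -- The image of the closed ball of radius `r / 2` contains the closed ball of radius `(‖B⁻¹‖⁻¹ -
  -- c) r / 2` about `f θ x₀`, and `hsmall` places `0` there.
  have hex : ∀ θ, ∃ x ∈ Metric.ball x₀ r, f θ x = 0 := by
    intro θ
    have hsub : Metric.closedBall x₀ (r / 2) ⊆ Metric.ball x₀ r :=
      Metric.closedBall_subset_ball (half_lt_self hr)
    obtain ⟨x, hx, hx0⟩ := (happ θ).surjOn_closedBall_of_nonlinearRightInverse
      B.toNonlinearRightInverse (half_pos hr).le hsub (a := 0) (by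
        rw [mem_closedBall_iff_norm', sub_zero]
        exact hsmall θ)
    exact ⟨x, hsub hx, hx0⟩
  choose x hxb hx0 using hex
  have huniq : ∀ θ, ∀ y ∈ Metric.ball x₀ r, f θ y = 0 → y = x θ := fun θ y hy h0 =>
    (happ θ).injOn (Or.inr hc) hy (hxb θ) (h0.trans (hx0 θ).symm)
  refine ⟨x, ?_, hxb, hx0, huniq⟩
  rw [contDiff_iff_contDiffAt]
  intro θ₀
  have cdf := hfat θ₀ (x θ₀) (hxb θ₀)
  have hinv : (fderiv ℝ (fun p : ℝ × E => f p.1 p.2) (θ₀, x θ₀) ∘L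
      ContinuousLinearMap.inr ℝ ℝ E).IsInvertible := by
    refine ContinuousLinearMap.isInvertible_of_norm_sub_lt B hc ?_
    rw [← (hfθ θ₀ _ (hxb θ₀)).fderiv]
    exact hB θ₀ _ (hxb θ₀)
  have hg := cdf.contDiffAt_implicitFunction one_ne_zero hinv
  -- Uniqueness in the fixed ball identifies the chosen solution with the local implicit function,
  -- which is `C¹`.
  refine hg.congr_of_eventuallyEq ?_
  have hgc : Tendsto (cdf.implicitFunction one_ne_zero hinv) (𝓝 θ₀) (𝓝 (x θ₀)) := by
    have := hg.continuousAt.tendsto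
    rwa [cdf.implicitFunction_apply_self] at this
  filter_upwards [cdf.eventually_apply_implicitFunction one_ne_zero hinv,
    hgc.eventually (Metric.isOpen_ball.mem_nhds (hxb θ₀))] with θ h1 h2
  exact (huniq θ _ h2 (by rw [← hx0 θ₀]; exact h1)).symm
/-! ### The loop argument -/

theorem hopf_neg_hopf {n : ℕ} (θ : ℝ) (z : Cn n) : hopf (-θ) (hopf θ z) = z := by
  rw [← hopf_add, neg_add_cancel, hopf_zero]

theorem symplecticL_hopf {n : ℕ} (θ : ℝ) (u v : Cn n) :
    symplecticL n (hopf θ u) (hopf θ v) = symplecticL n u v :=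
  symplecticL_smul_smul (norm_exp_hopf θ) u v

theorem continuous_hopf_comp {n : ℕ} {Y : Type*} [TopologicalSpace Y] {g : Y → ℝ} {f : Y → Cn n}
    (hg : Continuous g) (hf : Continuous f) : Continuous fun y => hopf (g y) (f y) := by
  unfold hopf
  fun_prop

/-- A loop whose rotated copy stays orthogonal to a fixed Lagrangian subspace has action density
`‖c‖²`. -/
theorem symplecticL_deriv_of_orthogonal {n : ℕ} {D : Rn n →L[ℝ] Cn n}
    (hinj : Function.Injective D) (hD : ∀ u v, symplecticL n (D u) (D v) = 0)
    {c c' : ℝ → Cn n} (hc : ∀ θ, HasDerivAt c (c' θ) θ)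
    (horth : ∀ θ v, symplecticL n (hopf (-θ) (c θ)) (Complex.I • D v) = 0) (θ : ℝ) :
    symplecticL n (c θ) (c' θ) = ‖c θ‖ ^ 2 := by
  have hν : HasDerivAt (fun θ => hopf (-θ) (c θ))
      (hopf (-θ) (-(Complex.I • c θ) + c' θ)) θ := by
    have h := (hasDerivAt_hopf (hc (- -θ) |>.scomp (-θ) (hasDerivAt_neg (-θ)))).scomp θ
      (hasDerivAt_neg θ)
    simp only [Function.comp_def, neg_neg] at h
    refine h.congr_deriv ?_
    simp only [hopf, smul_add, smul_neg, neg_smul, one_smul, neg_neg]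
  have h0 : ∀ v, symplecticL n (hopf (-θ) (-(Complex.I • c θ) + c' θ)) (Complex.I • D v) = 0 := by
    intro v
    have h1 := hasDerivAt_symplecticL hν (hasDerivAt_const θ (Complex.I • D v))
    rw [map_zero, add_zero] at h1
    refine h1.unique ((hasDerivAt_const θ (0 : ℝ)).congr_of_eventuallyEq ?_)
    exact Eventually.of_forall fun θ => horth θ v
  -- Both `ν = e^{-iθ} c` and `ν' = e^{-iθ}(c' - i c)` are orthogonal to the Lagrangian plane, so `0
  -- = ω(ν, ν') = ω(c, c') - ‖c‖²`.
  have h2 := symplecticL_eq_zero_of_orthogonal hinj hD (horth θ) h0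
  rw [symplecticL_hopf, map_add, map_neg, symplecticL_self_I] at h2
  linarith

/-- The loop `θ ↦ e^{iθ} χ(x θ)` in a Lagrangian submanifold of the sphere has the same action as
a Hopf circle. -/
theorem loopAction_hopf_param {n : ℕ} {S : Set (Cn n)} (hS : IsClosedLagrangian S)
    (hsph : S ⊆ Metric.sphere (0 : Cn n) 1) {χ : Rn n → Cn n} {x₀ y : Rn n} {r : ℝ}
    (hχ : ContDiffOn ℝ ∞ χ (Metric.ball x₀ r)) (hmem : ∀ x ∈ Metric.ball x₀ r, χ x ∈ S)
    (hinj : ∀ x ∈ Metric.ball x₀ r, Function.Injective (fderiv ℝ χ x))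
    (hy : y ∈ Metric.ball x₀ r) {x x' : ℝ → Rn n} (hx : ∀ θ, HasDerivAt x (x' θ) θ)
    (hx' : Continuous x') (hxb : ∀ θ, x θ ∈ Metric.ball x₀ r)
    (hper : x (2 * Real.pi) = x 0) :
    loopAction (fun θ => hopf θ (χ (x θ)))
      (fun θ => hopf θ (Complex.I • χ (x θ) + fderiv ℝ χ (x θ) (x' θ))) = 2 * Real.pi := by
  have hxc : Continuous x := continuous_iff_continuousAt.2 fun θ => (hx θ).continuousAt
  have hD : ∀ x ∈ Metric.ball x₀ r, HasFDerivAt χ (fderiv ℝ χ x) x := fun x hx =>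
    ((hχ.contDiffAt (Metric.isOpen_ball.mem_nhds hx)).differentiableAt (by simp)).hasFDerivAt
  have hev : ∀ x ∈ Metric.ball x₀ r, ∀ᶠ y in 𝓝 x, χ y ∈ S := fun x hx =>
    mem_of_superset (Metric.isOpen_ball.mem_nhds hx) hmem
  have hiso : ∀ x ∈ Metric.ball x₀ r, ∀ u v,
      symplecticL n (fderiv ℝ χ x u) (Complex.I • χ x + fderiv ℝ χ x v) = 0 := by
    intro x hx u v
    obtain ⟨w, hw⟩ := exists_eq_I_smul_tangent hS hsph (hD x hx) (hev x hx) (hinj x hx)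
    have ht := mem_tangentVectors_of_hasFDerivAt (hD x hx) (hev x hx)
    rw [hw, ← map_add]
    exact hS.isotropic _ (hmem x hx) _ (ht u) _ (ht _)
  -- Contracting `x` to the constant `y` inside the convex chart ball deforms the loop within `S` to
  -- the Hopf circle through `χ y`. No area is swept out, because both velocities are tangent to
  -- `S`.
  set P : ℝ → ℝ → Rn n := fun s θ => y + s • (x θ - y) with hP
  have hPc : Continuous fun p : ℝ × ℝ => P p.1 p.2 := by fun_prop
  have hPb : ∀ s ∈ Icc (0 : ℝ) 1, ∀ θ, P s θ ∈ Metric.ball x₀ r := fun s hs θ =>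
    (convex_ball x₀ r).add_smul_sub_mem hy (hxb θ) hs
  have hcP : ∀ {G : Type} [TopologicalSpace G] {g : Rn n → G}, ContinuousOn g (Metric.ball x₀ r) →
      ContinuousOn (fun p : ℝ × ℝ => g (P p.1 p.2)) (Icc 0 1 ×ˢ univ) := fun hg =>
    hg.comp hPc.continuousOn fun p hp => hPb p.1 hp.1 p.2
  have hDc : ContinuousOn (fderiv ℝ χ) (Metric.ball x₀ r) :=
    hχ.continuousOn_fderiv_of_isOpen Metric.isOpen_ball (by simp)
  have hec : Continuous fun p : ℝ × ℝ => Complex.exp (p.2 * Complex.I) := by fun_prop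
  have key := loopAction_eq_of_family (n := n) zero_le_one
    (c := fun s θ => hopf θ (χ (P s θ)))
    (cs := fun s θ => hopf θ (fderiv ℝ χ (P s θ) (x θ - y)))
    (cθ := fun s θ => hopf θ (Complex.I • χ (P s θ) + fderiv ℝ χ (P s θ) (s • x' θ)))
    (fun s hs θ => by
      have h1 : HasDerivAt (fun s => P s θ) (x θ - y) s := by
        exact (((hasDerivAt_id s).smul_const (x θ - y)).const_add y).congr_deriv (one_smul _ _)
      exact (((hD _ (hPb s hs θ)).comp_hasDerivAt s h1).const_smul
        (Complex.exp (θ * Complex.I))).hasDerivWithinAt)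
    (fun s hs θ => by
      have h1 : HasDerivAt (fun θ => P s θ) (s • x' θ) θ :=
        (((hx θ).sub_const y).const_smul s).const_add y
      exact hasDerivAt_hopf ((hD _ (hPb s hs θ)).comp_hasDerivAt θ h1))
    (by
      unfold hopf
      exact hec.continuousOn.smul ((hcP hDc).clm_apply (by fun_prop)))
    (by
      unfold hopf
      exact hec.continuousOn.smul (((hcP hχ.continuousOn).const_smul Complex.I).add
        ((hcP hDc).clm_apply (by fun_prop))))
    (fun s hs => by simp only [hopf_zero, hopf_two_pi, hP, hper])
    (fun s hs => by
      simp only [symplecticL_hopf, hiso _ (hPb s hs _), intervalIntegral.integral_zero])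
  have e1 : ∀ θ, P 1 θ = x θ := fun θ => by simp [hP]
  have e0 : ∀ θ, P 0 θ = y := fun θ => by simp [hP]
  simp only [e1, e0, one_smul, zero_smul, map_zero, add_zero] at key
  rw [key, loopAction]
  simp only [symplecticL_hopf, symplecticL_self_I, mem_sphere_zero_iff_norm.1 (hsph (hmem y hy))]
  simp

/-- First-order condition for the squared distance `ω(w - γ, i (w - γ))` along a curve `γ` in `S`.
-/
theorem orthogonal_tangentVectors_of_nearest {n : ℕ} {S : Set (Cn n)} {p w τ : Cn n}
    (hmin : ∀ q ∈ S, dist w p ≤ dist w q) (hτ : τ ∈ tangentVectors S p) :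
    symplecticL n (w - p) (Complex.I • τ) = 0 := by
  obtain ⟨γ, h0, hγ, hd⟩ := hτ
  have h1 : HasDerivAt (fun s => w - γ s) (-τ) 0 := hd.const_sub w
  have h2 : HasDerivAt (fun s => symplecticL n (w - γ s) (Complex.I • (w - γ s)))
      (symplecticL n (-τ) (Complex.I • (w - γ 0)) + symplecticL n (w - γ 0) (Complex.I • -τ)) 0 :=
    hasDerivAt_symplecticL h1 (h1.const_smul Complex.I)
  have h3 : IsLocalMin (fun s => symplecticL n (w - γ s) (Complex.I • (w - γ s))) 0 := by
    filter_upwards [hγ] with s hs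
    simp only [symplecticL_self_I, ← dist_eq_norm, h0]
    exact pow_le_pow_left₀ dist_nonneg (hmin _ hs) 2
  have h4 := h3.hasDerivAt_eq_zero h2
  rw [symplecticL_I_right_comm (-τ), h0, smul_neg, map_neg] at h4
  linarith

/-- If the Lagrangian `S` in the sphere is moved inside the ball and a point of it lies on a loop
which, after rotation, stays orthogonal to a tangent space, then that point is on the sphere. -/
theorem norm_eq_one_of_loop {n : ℕ} {a b : ℝ} {ψ : ℝ → Cn n → Cn n} {H : ℝ → Cn n → ℝ}
    {X : ℝ → Cn n → Cn n} (hψ : IsHamiltonianFlowOn a b ψ H X) (hab : a < b) {t : ℝ}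
    (ht : t ∈ Icc a b) {S : Set (Cn n)} (hS : IsClosedLagrangian S)
    (hsph : S ⊆ Metric.sphere (0 : Cn n) 1) (hball : ∀ q ∈ S, ‖ψ t q‖ ≤ 1)
    {χ : Rn n → Cn n} {x₀ y : Rn n} {r : ℝ}
    (hχ : ContDiffOn ℝ ∞ χ (Metric.ball x₀ r)) (hmem : ∀ x ∈ Metric.ball x₀ r, χ x ∈ S)
    (hinj : ∀ x ∈ Metric.ball x₀ r, Function.Injective (fderiv ℝ χ x))
    (hy : y ∈ Metric.ball x₀ r) {x : ℝ → Rn n} (hx : ContDiff ℝ 1 x)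
    (hxb : ∀ θ, x θ ∈ Metric.ball x₀ r) (hper : x (2 * Real.pi) = x 0)
    (horth : ∀ θ v, symplecticL n (hopf (-θ) (ψ t (hopf θ (χ (x θ)))))
      (Complex.I • fderiv ℝ χ y v) = 0) :
    ‖ψ t (χ (x 0))‖ = 1 := by
  have hx1 : ∀ θ, HasDerivAt x (deriv x θ) θ := fun θ =>
    (hx.differentiable one_ne_zero θ).hasDerivAt
  have hx2 : Continuous (deriv x) := hx.continuous_deriv le_rfl
  have hD : ∀ x ∈ Metric.ball x₀ r, HasFDerivAt χ (fderiv ℝ χ x) x := fun x hx =>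
    ((hχ.contDiffAt (Metric.isOpen_ball.mem_nhds hx)).differentiableAt (by simp)).hasFDerivAt
  have hev : ∀ᶠ z in 𝓝 y, χ z ∈ S :=
    mem_of_superset (Metric.isOpen_ball.mem_nhds hy) hmem
  set l : ℝ → Cn n := fun θ => hopf θ (χ (x θ)) with hl
  set l' : ℝ → Cn n := fun θ => hopf θ (Complex.I • χ (x θ) + fderiv ℝ χ (x θ) (deriv x θ))
    with hl'
  have hll' : ∀ θ, HasDerivAt l (l' θ) θ := fun θ =>
    hasDerivAt_hopf ((hD _ (hxb θ)).comp_hasDerivAt θ (hx1 θ))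
  have hcx : ∀ {G : Type} [TopologicalSpace G] {g : Rn n → G}, ContinuousOn g (Metric.ball x₀ r) →
      Continuous fun θ => g (x θ) := fun hg =>
    continuousOn_univ.1 (hg.comp hx.continuous.continuousOn fun θ _ => hxb θ)
  have hl'c : Continuous l' := continuous_hopf_comp continuous_id
    (((hcx hχ.continuousOn).const_smul Complex.I).add
      ((hcx (hχ.continuousOn_fderiv_of_isOpen Metric.isOpen_ball (by simp))).clm_apply hx2))
  have hlper : l (2 * Real.pi) = l 0 := by simp only [hl, hopf_zero, hopf_two_pi, hper]
  have hψt : ContDiff ℝ ∞ (ψ t) := hψ.smooth.contDiff_slice ht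
  have hact := hψ.loopAction_comp hab ht hll' hl'c hlper
  rw [loopAction_hopf_param hS hsph hχ hmem hinj hy hx1 hx2 hxb hper, loopAction] at hact
  have hcc' : ∀ θ, HasDerivAt (fun θ => ψ t (l θ)) (fderiv ℝ (ψ t) (l θ) (l' θ)) θ := fun θ =>
    (hψt.differentiable (by simp) _).hasFDerivAt.comp_hasDerivAt θ (hll' θ)
  have ht' := mem_tangentVectors_of_hasFDerivAt (hD y hy) hev
  have hdens := symplecticL_deriv_of_orthogonal (hinj y hy)
    (fun u v => hS.isotropic _ (hmem y hy) _ (ht' u) _ (ht' v)) hcc' horth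
  simp only [hdens] at hact
  have hc : Continuous fun θ => ‖ψ t (l θ)‖ ^ 2 :=
    (continuous_iff_continuousAt.2 fun θ => (hcc' θ).continuousAt).norm.pow 2
  -- Hopf invariance keeps the whole loop in `S`, where the ball bound is available.
  have hle : ∀ θ, ‖ψ t (l θ)‖ ≤ 1 := fun θ => hball _ (hS.hopf_mem hsph (hmem _ (hxb θ)) θ)
  have hl0 : l 0 = χ (x 0) := hopf_zero _
  rw [← hl0]
  refine le_antisymm (hle 0) ?_
  by_contra! hlt
  have hpos := intervalIntegral.integral_pos (f := fun θ => 1 - ‖ψ t (l θ)‖ ^ 2)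
    Real.two_pi_pos (continuous_const.sub hc).continuousOn
    (fun θ _ => sub_nonneg.2 (pow_le_one₀ (norm_nonneg _) (hle θ)))
    ⟨0, ⟨le_rfl, Real.two_pi_pos.le⟩, sub_pos.2 (pow_lt_one₀ (norm_nonneg _) hlt two_ne_zero)⟩
  rw [intervalIntegral.integral_sub (by simp) (hc.intervalIntegrable _ _), hact] at hpos
  simp at hpos
/-! ### The local step -/

/-- Excludes `n = 0`, so that the inverse of the Gram form has positive norm and the constants of
the implicit function theorem make sense. -/
theorem nontrivial_Rn_of_norm_eq_one {n : ℕ} {p : Cn n} (hp : ‖p‖ = 1) : Nontrivial (Rn n) := by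
  have hn : n ≠ 0 := by
    rintro rfl
    rw [Subsingleton.elim p 0, norm_zero] at hp
    exact zero_ne_one hp
  have : Nonempty (Fin n) := Fin.pos_iff_nonempty.1 (Nat.pos_of_ne_zero hn)
  infer_instance

/-- Testing a vector against `i` times the image of `D`. -/
noncomputable def normalTest {n : ℕ} (D : Rn n →L[ℝ] Cn n) : Cn n →L[ℝ] Rn n →L[ℝ] ℝ :=
  ((ContinuousLinearMap.compL ℝ (Rn n) (Cn n) ℝ).flip (Complex.I • D)).comp (symplecticL n)

theorem normalTest_apply {n : ℕ} (D : Rn n →L[ℝ] Cn n) (z : Cn n) (v : Rn n) :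
    normalTest D z v = symplecticL n z (Complex.I • D v) := rfl

theorem continuous_normalTest {n : ℕ} :
    Continuous (normalTest : (Rn n →L[ℝ] Cn n) → Cn n →L[ℝ] Rn n →L[ℝ] ℝ) := by
  unfold normalTest
  fun_prop

/-- The Gram form of an injective linear map. -/
theorem exists_gram_equiv {n : ℕ} {D : Rn n →L[ℝ] Cn n} (hD : Function.Injective D) :
    ∃ B : Rn n ≃L[ℝ] (Rn n →L[ℝ] ℝ),
      (B : Rn n →L[ℝ] (Rn n →L[ℝ] ℝ)) = (normalTest D).comp D := by
  have hinj : Function.Injective ((normalTest D).comp D : Rn n →ₗ[ℝ] (Rn n →L[ℝ] ℝ)) := by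
    rw [injective_iff_map_eq_zero]
    intro v hv
    have h : symplecticL n (D v) (Complex.I • D v) = 0 := by
      have := congrArg (fun L : Rn n →L[ℝ] ℝ => L v) hv
      exact this
    rw [symplecticL_self_I] at h
    have h' : D v = 0 := by simpa using h
    exact hD (by rw [h', map_zero])
  have hdim : Module.finrank ℝ (Rn n) = Module.finrank ℝ (Rn n →L[ℝ] ℝ) := by
    rw [← (LinearMap.toContinuousLinearMap : (Rn n →ₗ[ℝ] ℝ) ≃ₗ[ℝ] (Rn n →L[ℝ] ℝ)).finrank_eq]
    exact (Subspace.dual_finrank_eq).symm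
  refine ⟨(LinearMap.linearEquivOfInjective _ hinj hdim).toContinuousLinearEquiv, ?_⟩
  ext v w
  rfl

/-- The loops `θ ↦ e^{iθ} χ(x θ)` whose images under `ψ t` stay, after rotation, orthogonal to the
tangent space at `χ y`: they exist and are unique, uniformly for `t` near `a` and `y` near `x₀`. -/
theorem exists_uniform_loop {n : ℕ} {a b : ℝ} {ψ : ℝ → Cn n → Cn n} {H : ℝ → Cn n → ℝ}
    {X : ℝ → Cn n → Cn n} (hψ : IsHamiltonianFlowOn a b ψ H X) (hab : a < b) [Nontrivial (Rn n)]
    {χ : Rn n → Cn n} {x₀ : Rn n} {r : ℝ} (hr : 0 < r) (hχ : ContDiffOn ℝ ∞ χ (Metric.ball x₀ r))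
    (hinj : Function.Injective (fderiv ℝ χ x₀))
    (horth : ∀ v, symplecticL n (χ x₀) (Complex.I • fderiv ℝ χ x₀ v) = 0) :
    ∃ r₁, 0 < r₁ ∧ r₁ ≤ r ∧ ∃ δ > 0, δ ≤ r₁ ∧ ∀ t ∈ Icc a b, dist t a < δ →
      ∀ y ∈ Metric.ball x₀ δ, ∃ x : ℝ → Rn n, ContDiff ℝ 1 x ∧
        (∀ θ, x θ ∈ Metric.ball x₀ r₁) ∧
        (∀ θ, normalTest (fderiv ℝ χ y) (hopf (-θ) (ψ t (hopf θ (χ (x θ))))) = 0) ∧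
        ∀ θ, ∀ z ∈ Metric.ball x₀ r₁,
          normalTest (fderiv ℝ χ y) (hopf (-θ) (ψ t (hopf θ (χ z)))) = 0 → z = x θ := by
  have ha : a ∈ Icc a b := ⟨le_rfl, hab.le⟩
  have hψa : ψ a = id := funext hψ.init
  have hx₀ : x₀ ∈ Metric.ball x₀ r := Metric.mem_ball_self hr
  have hD : ∀ x ∈ Metric.ball x₀ r, HasFDerivAt χ (fderiv ℝ χ x) x := fun x hx =>
    ((hχ.contDiffAt (Metric.isOpen_ball.mem_nhds hx)).differentiableAt (by simp)).hasFDerivAt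
  have hDc : ContinuousOn (fderiv ℝ χ) (Metric.ball x₀ r) :=
    hχ.continuousOn_fderiv_of_isOpen Metric.isOpen_ball (by simp)
  obtain ⟨B, hB⟩ := exists_gram_equiv hinj
  -- The phase `e^{iθ}` is replaced by a point `u` of the compact unit circle; compactness gives
  -- estimates uniform in `θ`.
  set k : Set ℂ := Metric.sphere (0 : ℂ) 1 with hk
  have hkc : IsCompact k := isCompact_sphere _ _
  have hconj : ∀ u ∈ k, (starRingEnd ℂ) u * u = 1 := by
    intro u hu
    rw [← Complex.normSq_eq_conj_mul_self, Complex.normSq_eq_norm_sq,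
      mem_sphere_zero_iff_norm.1 hu]
    norm_num
  -- `W (t, y, x) u` is the derivative in `x` of the equation to be solved. At time `a` the
  -- rotations cancel, so at `(a, x₀, x₀)` it is the Gram form `B` for every `u`.
  let W : ℝ × Rn n × Rn n → ℂ → Rn n →L[ℝ] (Rn n →L[ℝ] ℝ) := fun q u =>
    (normalTest (fderiv ℝ χ q.2.1)).comp
      ((starRingEnd ℂ u) • ((fderiv ℝ (ψ q.1) (u • χ q.2.2)).comp (u • fderiv ℝ χ q.2.2)))
  have hWc : ContinuousOn (Function.uncurry W)
      ((Icc a b ×ˢ Metric.ball x₀ r ×ˢ Metric.ball x₀ r) ×ˢ k) := by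
    have c1 : ContinuousOn (fun q : (ℝ × Rn n × Rn n) × ℂ => fderiv ℝ χ q.1.2.1)
        ((Icc a b ×ˢ Metric.ball x₀ r ×ˢ Metric.ball x₀ r) ×ˢ k) :=
      hDc.comp (by fun_prop) fun q hq => hq.1.2.1
    have c2 : ContinuousOn (fun q : (ℝ × Rn n × Rn n) × ℂ => fderiv ℝ χ q.1.2.2)
        ((Icc a b ×ˢ Metric.ball x₀ r ×ˢ Metric.ball x₀ r) ×ˢ k) :=
      hDc.comp (by fun_prop) fun q hq => hq.1.2.2
    have c3 : ContinuousOn (fun q : (ℝ × Rn n × Rn n) × ℂ => χ q.1.2.2)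
        ((Icc a b ×ˢ Metric.ball x₀ r ×ˢ Metric.ball x₀ r) ×ˢ k) :=
      hχ.continuousOn.comp (by fun_prop) fun q hq => hq.1.2.2
    have c4 : ContinuousOn (fun q : (ℝ × Rn n × Rn n) × ℂ => fderiv ℝ (ψ q.1.1) (q.2 • χ q.1.2.2))
        ((Icc a b ×ˢ Metric.ball x₀ r ×ˢ Metric.ball x₀ r) ×ˢ k) :=
      (hψ.smooth.continuousOn_fderiv_slice hab).comp
        (f := fun q : (ℝ × Rn n × Rn n) × ℂ => (q.1.1, q.2 • χ q.1.2.2))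
        ((by fun_prop : Continuous fun q : (ℝ × Rn n × Rn n) × ℂ => q.1.1).continuousOn.prodMk
          (continuousOn_snd.smul c3)) fun q hq => ⟨hq.1.1, mem_univ _⟩
    refine ContinuousOn.clm_comp (continuous_normalTest.comp_continuousOn c1) ?_
    exact (Complex.continuous_conj.comp continuous_snd).continuousOn.smul
      (c4.clm_comp (continuousOn_snd.smul c2))
  have hW0 : ∀ u ∈ k, W (a, x₀, x₀) u = B := by
    intro u hu
    rw [hB]
    ext v w
    simp [W, hψa, smul_smul, hconj u hu]
  -- `V (t, y) u` is the value of the equation at `x₀`. It vanishes at `(a, x₀)` because the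
  -- position vector is normal to `S`.
  let V : ℝ × Rn n → ℂ → Rn n →L[ℝ] ℝ := fun q u =>
    normalTest (fderiv ℝ χ q.2) ((starRingEnd ℂ u) • ψ q.1 (u • χ x₀))
  have hVc : ContinuousOn (Function.uncurry V) ((Icc a b ×ˢ Metric.ball x₀ r) ×ˢ k) := by
    have c1 : ContinuousOn (fun q : (ℝ × Rn n) × ℂ => fderiv ℝ χ q.1.2)
        ((Icc a b ×ˢ Metric.ball x₀ r) ×ˢ k) :=
      hDc.comp (by fun_prop) fun q hq => hq.1.2
    have c4 : ContinuousOn (fun q : (ℝ × Rn n) × ℂ => ψ q.1.1 (q.2 • χ x₀))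
        ((Icc a b ×ˢ Metric.ball x₀ r) ×ˢ k) :=
      hψ.smooth.continuousOn.comp
        (f := fun q : (ℝ × Rn n) × ℂ => (q.1.1, q.2 • χ x₀))
        (by fun_prop) fun q hq => ⟨hq.1.1, mem_univ _⟩
    exact (continuous_normalTest.comp_continuousOn c1).clm_apply
      ((Complex.continuous_conj.comp continuous_snd).continuousOn.smul c4)
  have hV0 : ∀ u ∈ k, V (a, x₀) u = 0 := by
    intro u hu
    ext v
    simp only [V, hψa, id, smul_smul, hconj u hu, one_smul, normalTest_apply]
    exact horth v
  set N : NNReal := ‖(B.symm : (Rn n →L[ℝ] ℝ) →L[ℝ] Rn n)‖₊ with hN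
  have hNpos : 0 < N := by
    have := B.norm_symm_pos
    exact this
  set c : NNReal := N⁻¹ / 2 with hc
  have hcpos : 0 < c := by positivity
  have hcN : c < N⁻¹ := NNReal.half_lt_self (inv_pos.2 hNpos).ne'
  obtain ⟨v₁, hv₁, hv₁'⟩ := hkc.mem_uniformity_of_prod (f := W)
    (s := Icc a b ×ˢ Metric.ball x₀ r ×ˢ Metric.ball x₀ r) (q := (a, x₀, x₀)) hWc ⟨ha, hx₀, hx₀⟩
    (Metric.dist_mem_uniformity (NNReal.coe_pos.2 hcpos))
  obtain ⟨δ₁, hδ₁, hδ₁v⟩ := Metric.mem_nhdsWithin_iff.1 hv₁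
  set r₁ := min δ₁ r with hr₁
  have hr₁pos : 0 < r₁ := lt_min hδ₁ hr
  have hsub₁ : Metric.ball x₀ r₁ ⊆ Metric.ball x₀ r := Metric.ball_subset_ball (min_le_right _ _)
  set η : ℝ := ((N : ℝ)⁻¹ - c) * (r₁ / 2) with hη
  have hηpos : 0 < η := by
    have : (c : ℝ) < (N : ℝ)⁻¹ := by exact_mod_cast hcN
    exact mul_pos (sub_pos.2 this) (half_pos hr₁pos)
  obtain ⟨v₂, hv₂, hv₂'⟩ := hkc.mem_uniformity_of_prod (f := V)
    (s := Icc a b ×ˢ Metric.ball x₀ r) (q := (a, x₀)) hVc ⟨ha, hx₀⟩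
    (Metric.dist_mem_uniformity hηpos)
  obtain ⟨δ₂, hδ₂, hδ₂v⟩ := Metric.mem_nhdsWithin_iff.1 hv₂
  refine ⟨r₁, hr₁pos, min_le_right _ _, min r₁ δ₂, lt_min hr₁pos hδ₂, min_le_left _ _, ?_⟩
  intro t ht hta y hyb
  have hta₁ : dist t a < δ₁ := hta.trans_le ((min_le_left _ _).trans (min_le_left _ _))
  have hta₂ : dist t a < δ₂ := hta.trans_le (min_le_right _ _)
  have hyb₁ : y ∈ Metric.ball x₀ r₁ := Metric.ball_subset_ball (min_le_left _ _) hyb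
  let f : ℝ → Rn n → Rn n →L[ℝ] ℝ := fun θ x =>
    normalTest (fderiv ℝ χ y) (hopf (-θ) (ψ t (hopf θ (χ x))))
  have hψt : ContDiff ℝ ∞ (ψ t) := hψ.smooth.contDiff_slice ht
  have hexp : ∀ θ : ℝ, Complex.exp (θ * Complex.I) ∈ k := fun θ =>
    mem_sphere_zero_iff_norm.2 (norm_exp_hopf θ)
  have hexp' : ∀ θ : ℝ, Complex.exp ((-θ : ℝ) * Complex.I) =
      starRingEnd ℂ (Complex.exp (θ * Complex.I)) := by
    intro θ
    rw [← Complex.exp_conj]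
    simp
  have hf : ContDiffOn ℝ 1 (fun p : ℝ × Rn n => f p.1 p.2) (univ ×ˢ Metric.ball x₀ r₁) := by
    have d0 : ContDiff ℝ 1 fun p : ℝ × Rn n => Complex.exp ((p.1 : ℂ) * Complex.I) :=
      ((Complex.ofRealCLM.contDiff.comp contDiff_fst).mul contDiff_const).cexp
    have d0' : ContDiff ℝ 1 fun p : ℝ × Rn n => Complex.exp (((-p.1 : ℝ) : ℂ) * Complex.I) :=
      ((Complex.ofRealCLM.contDiff.comp contDiff_fst.neg).mul contDiff_const).cexp
    have d1 : ContDiffOn ℝ 1 (fun p : ℝ × Rn n => χ p.2) (univ ×ˢ Metric.ball x₀ r₁) :=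
      ((hχ.of_le (by exact_mod_cast le_top)).mono hsub₁).comp contDiffOn_snd fun p hp => hp.2
    have d2 : ContDiffOn ℝ 1 (fun p : ℝ × Rn n => ψ t (hopf p.1 (χ p.2)))
        (univ ×ˢ Metric.ball x₀ r₁) :=
      (hψt.of_le (by exact_mod_cast le_top)).comp_contDiffOn (d0.contDiffOn.smul d1)
    exact (normalTest (fderiv ℝ χ y)).contDiff.comp_contDiffOn (d0'.contDiffOn.smul d2)
  have hfd : ∀ θ, ∀ x ∈ Metric.ball x₀ r₁,
      fderiv ℝ (f θ) x = W (t, y, x) (Complex.exp (θ * Complex.I)) := by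
    intro θ x hx
    refine HasFDerivAt.fderiv ?_
    have h1 : HasFDerivAt (fun x => hopf θ (χ x))
        (Complex.exp (θ * Complex.I) • fderiv ℝ χ x) x :=
      (hD x (hsub₁ hx)).const_smul (Complex.exp (θ * Complex.I))
    have h2 := ((hψt.differentiable (by simp) (hopf θ (χ x))).hasFDerivAt.comp x h1).const_smul
      (Complex.exp ((-θ : ℝ) * Complex.I))
    have h3 := (normalTest (fderiv ℝ χ y)).hasFDerivAt.comp x h2
    refine h3.congr_fderiv ?_
    rw [hexp']
    rfl
  have hfB : ∀ θ, ∀ x ∈ Metric.ball x₀ r₁,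
      ‖fderiv ℝ (f θ) x - (B : Rn n →L[ℝ] (Rn n →L[ℝ] ℝ))‖ ≤ c := by
    intro θ x hx
    rw [hfd θ x hx, ← hW0 _ (hexp θ)]
    have hmem : (t, y, x) ∈ v₁ := by
      refine hδ₁v ⟨?_, ht, hsub₁ hyb₁, hsub₁ hx⟩
      simp only [Metric.mem_ball, Prod.dist_eq]
      exact max_lt hta₁ (max_lt (lt_of_lt_of_le hyb₁ (min_le_left _ _))
        (lt_of_lt_of_le hx (min_le_left _ _)))
    have h : dist (W (t, y, x) (Complex.exp (θ * Complex.I)))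
        (W (a, x₀, x₀) (Complex.exp (θ * Complex.I))) < c := hv₁' _ hmem _ (hexp θ)
    have e := dist_eq_norm (W (t, y, x) (Complex.exp (θ * Complex.I)))
      (W (a, x₀, x₀) (Complex.exp (θ * Complex.I)))
    exact e.symm.trans_le h.le
  have hfsmall : ∀ θ, ‖f θ x₀‖ ≤ η := by
    intro θ
    have h1 := hv₂' (t, y) (hδ₂v ⟨by
      simp only [Metric.mem_ball, Prod.dist_eq]
      exact max_lt hta₂ (lt_of_lt_of_le hyb (min_le_right _ _)), ht, hsub₁ hyb₁⟩) _ (hexp θ)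
    simp only [mem_ofPred_eq, hV0 _ (hexp θ), dist_zero_right] at h1
    have h2 : f θ x₀ = V (t, y) (Complex.exp (θ * Complex.I)) := by
      simp only [f, V, hopf, hexp']
    rw [h2]
    exact h1.le
  exact exists_contDiff_implicit hr₁pos hf B hcN hfB hfsmall

/-- The plane against which the loop is tested is the tangent space at the point of `S` nearest to
`ψ t q`; this choice makes the loop start at `q` itself. -/
theorem exists_local_step {n : ℕ} {a b : ℝ} {ψ : ℝ → Cn n → Cn n} {H : ℝ → Cn n → ℝ}
    {X : ℝ → Cn n → Cn n} (hψ : IsHamiltonianFlowOn a b ψ H X) (hab : a < b)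
    {S : Set (Cn n)} (hS : IsClosedLagrangian S)
    (hsph : S ⊆ Metric.sphere (0 : Cn n) 1) {p₀ : Cn n} (hp₀ : p₀ ∈ S) :
    ∃ δ > 0, ∀ t ∈ Icc a b, dist t a < δ → (∀ q ∈ S, ‖ψ t q‖ ≤ 1) →
      ∀ q ∈ S, dist q p₀ < δ → ‖ψ t q‖ = 1 := by
  obtain ⟨χ, κ, x₀, r, hr, hχ, hmem, hinj, hχ0, hκ0, hκ, hχκ⟩ :=
    hS.submanifold.exists_isLocalParam hp₀
  have := nontrivial_Rn_of_norm_eq_one (mem_sphere_zero_iff_norm.1 (hsph hp₀))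
  have ha : a ∈ Icc a b := ⟨le_rfl, hab.le⟩
  have hψa : ψ a = id := funext hψ.init
  have hx₀ : x₀ ∈ Metric.ball x₀ r := Metric.mem_ball_self hr
  have hD : ∀ x ∈ Metric.ball x₀ r, HasFDerivAt χ (fderiv ℝ χ x) x := fun x hx =>
    ((hχ.contDiffAt (Metric.isOpen_ball.mem_nhds hx)).differentiableAt (by simp)).hasFDerivAt
  have htan : ∀ x ∈ Metric.ball x₀ r, ∀ v, fderiv ℝ χ x v ∈ tangentVectors S (χ x) :=
    fun x hx => mem_tangentVectors_of_hasFDerivAt (hD x hx)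
      (mem_of_superset (Metric.isOpen_ball.mem_nhds hx) hmem)
  obtain ⟨r₁, hr₁, hr₁r, δ₃, hδ₃, hδ₃r, hloop⟩ := exists_uniform_loop hψ hab hr hχ
    (hinj x₀ hx₀) (fun v => inner_tangentVectors_sphere hsph (htan x₀ hx₀ v))
  have hsub₁ : Metric.ball x₀ r₁ ⊆ Metric.ball x₀ r := Metric.ball_subset_ball hr₁r
  have hev : ∀ᶠ q in 𝓝[S] p₀, κ q ∈ Metric.ball x₀ δ₃ ∧ χ (κ q) = q := by
    refine Filter.Eventually.and ?_ hχκ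
    have : Tendsto κ (𝓝 p₀) (𝓝 x₀) := by rw [← hκ0]; exact hκ
    exact (this.mono_left nhdsWithin_le_nhds).eventually (Metric.ball_mem_nhds _ hδ₃)
  obtain ⟨ε₁, hε₁, hε₁S⟩ := Metric.mem_nhdsWithin_iff.1 hev
  -- The nearest point `p` is within `2 · dist (ψ t q) p₀ < ε₁ / 2` of `p₀`, hence in the range of
  -- the parametrisation.
  have hψc : ∀ᶠ q in 𝓝[Icc a b ×ˢ univ] (a, p₀), dist (ψ q.1 q.2) p₀ < ε₁ / 4 := by
    have := (hψ.smooth.continuousOn (a, p₀) ⟨ha, mem_univ _⟩).tendsto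
    simp only [hψa, id] at this
    exact this.eventually (Metric.ball_mem_nhds _ (by positivity))
  obtain ⟨ε₂, hε₂, hε₂S⟩ := Metric.mem_nhdsWithin_iff.1 hψc
  refine ⟨min δ₃ (min ε₂ (ε₁ / 4)), by positivity, ?_⟩
  intro t ht hta hball q hq hqp
  simp only [lt_min_iff] at hta hqp
  have hψq : dist (ψ t q) p₀ < ε₁ / 4 :=
    hε₂S (a := (t, q)) ⟨by rw [Metric.mem_ball, Prod.dist_eq]; exact max_lt hta.2.1 hqp.2.1,
      ht, mem_univ _⟩
  obtain ⟨p, hp, hpmin⟩ := hS.isCompact.exists_isMinOn ⟨q, hq⟩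
    (f := fun z => dist (ψ t q) z) (by fun_prop)
  have hpmin' : ∀ z ∈ S, dist (ψ t q) p ≤ dist (ψ t q) z := fun z hz => hpmin hz
  have hpp₀ : dist p p₀ < ε₁ := by
    have h1 := dist_triangle_left p p₀ (ψ t q)
    have h2 := hpmin' p₀ hp₀
    linarith
  obtain ⟨hyb, hyp⟩ := hε₁S (a := p) ⟨hpp₀, hp⟩
  obtain ⟨hzb, hzq⟩ := hε₁S (a := q) ⟨lt_of_lt_of_le hqp.2.2 (by linarith), hq⟩
  set y := κ p with hy
  set z := κ q with hz
  have hyb₁ : y ∈ Metric.ball x₀ r₁ := Metric.ball_subset_ball hδ₃r hyb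
  have hzb₁ : z ∈ Metric.ball x₀ r₁ := Metric.ball_subset_ball hδ₃r hzb
  obtain ⟨x, hxd, hxb, hx0, hxu⟩ := hloop t ht hta.1 y hyb
  -- The equations at `θ = 0` and `θ = 2π` coincide, so uniqueness of the solution closes the loop.
  have hper : x (2 * Real.pi) = x 0 := by
    refine hxu 0 _ (hxb _) ?_
    have h := hx0 (2 * Real.pi)
    rw [hopf_two_pi, ← hopf_two_pi (ψ t (χ (x (2 * Real.pi)))), hopf_neg_hopf] at h
    simpa only [neg_zero, hopf_zero] using h
  -- `ψ t q - p` is normal to `S` at `p` by minimality and `p` by sphericity. Hence `ψ t q` is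
  -- normal, and the coordinate of `q` solves the equation at `θ = 0`.
  have hz0 : z = x 0 := by
    refine hxu 0 z hzb₁ ?_
    ext v
    simp only [neg_zero, hopf_zero, hzq, normalTest_apply, zero_apply]
    have hτ : fderiv ℝ χ y v ∈ tangentVectors S p := by
      rw [← hyp]
      exact htan y (hsub₁ hyb₁) v
    have h1 := orthogonal_tangentVectors_of_nearest hpmin' hτ
    rw [map_sub, sub_apply, inner_tangentVectors_sphere hsph hτ, sub_zero] at h1
    exact h1
  rw [← hzq, hz0]
  refine norm_eq_one_of_loop hψ hab ht hS hsph hball (hχ.mono hsub₁)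
    (fun x hx => hmem x (hsub₁ hx)) (fun x hx => hinj x (hsub₁ hx)) hyb₁ hxd hxb hper ?_
  intro θ v
  exact congrArg (fun L : Rn n →L[ℝ] ℝ => L v) (hx0 θ)
/-! ### The theorem -/

section Diffeomorphisms

variable {n : ℕ} {φ : ℝ → Diffeomorph 𝓘(ℝ, Cn n) 𝓘(ℝ, Cn n) (Cn n) (Cn n) ∞}
  {H : ℝ → Cn n → ℝ} {X : ℝ → Cn n → Cn n}

theorem IsHamiltonianIsotopy.exists_flow (hφ : IsHamiltonianIsotopy φ) :
    ∃ H X, IsHamiltonianFlowOn 0 1 (fun t z => φ t z) H X := by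
  obtain ⟨h1, h2, H, X, h3, h4⟩ := hφ
  exact ⟨H, X, h1, h2, h3, fun t ht => (h4 t ht).1, fun t ht => (h4 t ht).2⟩

/-- A Hamiltonian flow can be restarted at any time. -/
theorem IsHamiltonianFlowOn.restart (hφ : IsHamiltonianFlowOn 0 1 (fun t z => φ t z) H X) {a : ℝ}
    (ha : a ∈ Icc (0 : ℝ) 1) :
    IsHamiltonianFlowOn a 1 (fun t z => φ t ((φ a).symm z)) H X where
  smooth := by
    have hs : ContDiff ℝ ∞ ((φ a).symm : Cn n → Cn n) := (φ a).symm.contMDiff.contDiff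
    exact hφ.smooth.comp (f := fun p : ℝ × Cn n => (p.1, (φ a).symm p.2))
      (contDiff_fst.prodMk (hs.comp contDiff_snd)).contDiffOn
      fun p hp => ⟨⟨ha.1.trans hp.1.1, hp.1.2⟩, mem_univ _⟩
  init x := (φ a).apply_symm_apply x
  smooth_ham := hφ.smooth_ham.mono (prod_mono (Icc_subset_Icc_left ha.1) Subset.rfl)
  ham t ht := hφ.ham t ⟨ha.1.trans ht.1, ht.2⟩
  deriv t ht x := (hφ.deriv t ⟨ha.1.trans ht.1, ht.2⟩ _).mono (Icc_subset_Icc_left ha.1)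

theorem IsHamiltonianFlowOn.image_isClosedLagrangian
    (hφ : IsHamiltonianFlowOn 0 1 (fun t z => φ t z) H X) {a : ℝ} (ha : a ∈ Icc (0 : ℝ) 1)
    {L : Set (Cn n)} (hL : IsClosedLagrangian L) : IsClosedLagrangian (φ a '' L) :=
  hL.image (φ a).toHomeomorph (φ a).contMDiff.contDiff (φ a).symm.contMDiff.contDiff
    fun z u v => hφ.symplectic one_pos ha z u v

theorem IsHamiltonianFlowOn.continuousOn_orbit
    (hφ : IsHamiltonianFlowOn 0 1 (fun t z => φ t z) H X) (q : Cn n) :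
    ContinuousOn (fun t => φ t q) (Icc 0 1) :=
  fun t ht => (hφ.deriv t ht q).continuousWithinAt

/-- A closed Lagrangian submanifold of the sphere that is moved inside the ball stays in the
sphere. -/
theorem IsHamiltonianFlowOn.norm_eq_one (hφ : IsHamiltonianFlowOn 0 1 (fun t z => φ t z) H X)
    {L : Set (Cn n)} (hL : IsClosedLagrangian L) (hsph : L ⊆ Metric.sphere (0 : Cn n) 1) {t₁ : ℝ}
    (ht₁ : t₁ ∈ Icc (0 : ℝ) 1) (hball : ∀ t ∈ Icc 0 t₁, ∀ q ∈ L, ‖φ t q‖ ≤ 1) :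
    ∀ t ∈ Icc 0 t₁, ∀ q ∈ L, ‖φ t q‖ = 1 := by
  have hsub : Icc 0 t₁ ⊆ {t | ∀ q ∈ L, ‖φ t q‖ = 1} := by
    refine IsClosed.Icc_subset_of_forall_exists_gt ?_ ?_ ?_
    · have : {t | ∀ q ∈ L, ‖φ t q‖ = 1} ∩ Icc 0 t₁ =
          Icc 0 t₁ ∩ ⋂ q ∈ L, (Icc 0 t₁ ∩ (fun t => ‖φ t q‖) ⁻¹' {1}) := by
        ext t
        simp only [mem_inter_iff, mem_iInter, mem_preimage, mem_singleton_iff, mem_ofPred_eq]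
        exact ⟨fun h => ⟨h.2, fun q hq => ⟨h.2, h.1 q hq⟩⟩, fun h => ⟨fun q hq => (h.2 q hq).2, h.1⟩⟩
      rw [this]
      refine isClosed_Icc.inter (isClosed_biInter fun q _ => ?_)
      exact ((hφ.continuousOn_orbit q).norm.mono
        (Icc_subset_Icc_right ht₁.2)).preimage_isClosed_of_isClosed isClosed_Icc isClosed_singleton
    · intro q hq
      have h0 : φ 0 q = q := hφ.init q
      rw [h0]
      exact mem_sphere_zero_iff_norm.1 (hsph hq)
    · rintro a ⟨has, ha0, hat⟩ y hy
      have ha1 : a < 1 := hat.trans_le ht₁.2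
      have haI : a ∈ Icc (0 : ℝ) 1 := ⟨ha0, ha1.le⟩
      have hS := hφ.image_isClosedLagrangian haI hL
      have hSsph : φ a '' L ⊆ Metric.sphere (0 : Cn n) 1 := by
        rintro _ ⟨q, hq, rfl⟩
        exact mem_sphere_zero_iff_norm.2 (has q hq)
      -- Carrying the side conditions as implications leaves a statement local in `(t, q)`, so
      -- compactness of `φ a '' L` merges the local radii into one.
      have hloc : ∀ᶠ t in 𝓝 a, ∀ q ∈ φ a '' L, t ∈ Icc a 1 →
          (∀ q ∈ φ a '' L, ‖φ t ((φ a).symm q)‖ ≤ 1) → q ∈ φ a '' L →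
          ‖φ t ((φ a).symm q)‖ = 1 := by
        refine hS.isCompact.eventually_forall_of_forall_eventually fun p hp => ?_
        obtain ⟨δ, hδ, h⟩ := exists_local_step (hφ.restart haI) ha1 hS hSsph hp
        rw [nhds_prod_eq]
        filter_upwards [prod_mem_prod (Metric.ball_mem_nhds a hδ) (Metric.ball_mem_nhds p hδ)]
          with z hz h1 h2 h3
        exact h z.1 h1 hz.1 h2 z.2 h3 hz.2
      obtain ⟨ε, hε, hεloc⟩ := Metric.eventually_nhds_iff_ball.1 hloc
      -- A time after `a` within the uniform radius, exceeding neither `y` nor `t₁`.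
      set t := a + min (ε / 2) (min y t₁ - a) with ht
      have hmin : 0 < min (ε / 2) (min y t₁ - a) :=
        lt_min (half_pos hε) (sub_pos.2 (lt_min hy hat))
      have hle1 := min_le_left (ε / 2) (min y t₁ - a)
      have hle2 := min_le_right (ε / 2) (min y t₁ - a)
      have hle3 := min_le_left y t₁
      have hle4 := min_le_right y t₁
      have htt₁ : t ≤ t₁ := by linarith
      refine ⟨t, fun q hq => ?_, by linarith, by linarith⟩
      have := hεloc t (by rw [Metric.mem_ball, Real.dist_eq, abs_lt]; constructor <;> linarith)
        (φ a q) ⟨q, hq, rfl⟩ ⟨by linarith, htt₁.trans ht₁.2⟩ (by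
          rintro _ ⟨q', hq', rfl⟩
          rw [(φ a).symm_apply_apply]
          exact hball t ⟨by linarith, htt₁⟩ q' hq') ⟨q, hq, rfl⟩
      rwa [(φ a).symm_apply_apply] at this
  exact fun t ht => hsub ht

end Diffeomorphisms

theorem hopf_ne_self {n : ℕ} {p : Cn n} (hp : p ≠ 0) {θ : ℝ} (h0 : 0 < θ) (hπ : θ < Real.pi) :
    hopf θ p ≠ p := by
  intro h
  have h1 : (Complex.exp (θ * Complex.I) - 1) • p = 0 := by
    rw [sub_smul, one_smul, sub_eq_zero]
    exact h
  have h2 := (smul_eq_zero.1 h1).resolve_right hp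
  have h3 := congrArg Complex.im h2
  rw [Complex.sub_im, Complex.exp_ofReal_mul_I_im] at h3
  have h4 := Real.sin_pos_of_pos_of_lt_pi h0 hπ
  simp at h3
  linarith

theorem mainTheorem11 (n : ℕ) :
    (∀ L : ℝ → Set (Cn n), IsLagrangianHamiltonianIsotopy L →
      (∀ t ∈ Set.Icc (0 : ℝ) 1, L t ⊆ Metric.closedBall (0 : Cn n) 1) →
      L 0 ⊆ Metric.sphere (0 : Cn n) 1 →
      ∀ t ∈ Set.Icc (0 : ℝ) 1, L t ⊆ Metric.sphere (0 : Cn n) 1) ∧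
    (∀ L : Set (Cn n), IsClosedLagrangian L → L ⊆ Metric.sphere (0 : Cn n) 1 →
      ∀ φ : ℝ → Diffeomorph 𝓘(ℝ, Cn n) 𝓘(ℝ, Cn n) (Cn n) (Cn n) ∞, IsHamiltonianIsotopy φ →
      ∀ p ∈ L, ∀ t ∈ Set.Icc (0 : ℝ) 1, φ t p ∈ Metric.ball (0 : Cn n) 1 →
      ∃ s ∈ Set.Icc (0 : ℝ) t, ∃ q ∈ L, q ≠ p ∧ φ s q ∉ Metric.closedBall (0 : Cn n) 1) := by
  refine ⟨?_, ?_⟩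
  · rintro L ⟨hL, φ, hφ, hLt⟩ hball hsph t ht
    obtain ⟨H, X, hflow⟩ := hφ.exists_flow
    have h := hflow.norm_eq_one hL hsph (t₁ := 1) ⟨zero_le_one, le_rfl⟩ fun s hs q hq =>
      mem_closedBall_zero_iff.1 (hball s hs (by rw [hLt s hs]; exact ⟨q, hq, rfl⟩))
    rw [hLt t ht]
    rintro _ ⟨q, hq, rfl⟩
    exact mem_sphere_zero_iff_norm.2 (h t ht q hq)
  · intro L hL hsph φ hφ p hp t ht hpt
    obtain ⟨H, X, hflow⟩ := hφ.exists_flow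
    by_contra! hcon
    have hp0 : p ≠ 0 := by
      rintro rfl
      simpa using mem_sphere_zero_iff_norm.1 (hsph hp)
    -- The negated conclusion bounds every point except `p`. The points `e^{iθ} p` with small `θ >
    -- 0` lie in `L`, differ from `p` and converge to it, so the bound passes to `p`.
    have hball : ∀ s ∈ Icc 0 t, ∀ q ∈ L, ‖φ s q‖ ≤ 1 := by
      intro s hs q hq
      by_cases hqp : q = p
      · subst hqp
        have hlim : Tendsto (fun θ => ‖φ s (hopf θ q)‖) (𝓝[>] 0) (𝓝 ‖φ s q‖) := by
          have hc : Continuous fun θ => ‖φ s (hopf θ q)‖ :=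
            ((φ s).continuous.comp (continuous_hopf q)).norm
          have := hc.tendsto 0
          rw [hopf_zero] at this
          exact this.mono_left nhdsWithin_le_nhds
        refine le_of_tendsto hlim ?_
        filter_upwards [Ioo_mem_nhdsGT Real.pi_pos] with θ hθ
        exact mem_closedBall_zero_iff.1
          (hcon s hs _ (hL.hopf_mem hsph hp θ) (hopf_ne_self hp0 hθ.1 hθ.2))
      · exact mem_closedBall_zero_iff.1 (hcon s hs q hq hqp)
    have h := hflow.norm_eq_one hL hsph ht hball t ⟨ht.1, le_rfl⟩ p hp
    exact absurd (mem_ball_zero_iff.1 hpt) (by rw [h]; exact lt_irrefl 1)
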